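/- For $p\in(0,1)$ and $\lambda\in(0,1)$ let $\nu_\lambda^p$ denote the $p$-biased Bernoulli convolution, i.e. the distribution of $\sum_{n\ge 1} i_n\lambda^n$, where the $i_n$ are independent, $i_n=0$ with probability $p$ and $i_n=1$ with probability $1-p$. For a Borel probability measure $\mu$ on $\mathbb R$ let $$d(\mu,x)=\lim_{r\searrow 0}\frac{\log\mu(B(x,r))}{\log r},\qquad \underline d(\mu,x)=\liminf_{r\searrow 0}\frac{\log\mu(B(x,r))}{\log r}$$ be the local dimension (when the limit exists) and the lower local dimension of $\mu$ at $x$, where $B(x,r)$ is the open ball and $\log 0=-\infty$. Let $\lambda_*=0.66847$ or, more generally, let $\lambda_*\in(0,1)$ be any number with the following transversality property: there is $C>0$ such that for all $(i_n)_{n\ge1},(j_n)_{n\ge1}\in\{0,1\}^{\mathbb N}$ with $i_1\ne j_1$ and all $\delta>0$, the Lebesgue measure of $\{\lambda\in(0,\lambda_*): |\sum_{n\ge1} i_n\lambda^n-\sum_{n\ge1} j_n\lambda^n|<\delta\}$ is less than $C\delta$. Fix $p,q\in(0,1)$. Then: (i) For Lebesgue-almost every $\lambda\in\bigl(0,\min\{\lambda_*,\,p^q(1-p)^{1-q}\}\bigr)$,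 for $\nu_\lambda^q$-almost every $x$ the local dimension $d(\nu_\lambda^p,x)$ exists and $$d(\nu_\lambda^p,x)=\frac{q\log p+(1-q)\log(1-p)}{\log\lambda}.$$ (ii) If $p^q(1-p)^{1-q}<\lambda_*$, then for Lebesgue-almost every $\lambda\in\bigl(p^q(1-p)^{1-q},\lambda_*\bigr)$, $$\underline d(\nu_\lambda^p,x)\ge 1\quad\text{for }\nu_\lambda^q\text{-almost every }x.$$ -/

import Mathlib

open Set Filter Topology MeasureTheory

/-- The local dimension quotient `log μ(B(x,r)) / log r`, with `B(x,r)` the open ball, computed in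
`[-∞, ∞]` with `log 0 = -∞` (so that, for `0 < r < 1`, it is `+∞` when the ball is null). -/
noncomputable def localDimQuotient (μ : Measure ℝ) (x r : ℝ) : EReal :=
  ENNReal.log (μ (Metric.ball x r)) / ((Real.log r : ℝ) : EReal)

/-- The local dimension of `μ` at `x` exists and equals `d`. -/
def HasLocalDim (μ : Measure ℝ) (x : ℝ) (d : EReal) : Prop :=
  Tendsto (fun r : ℝ => localDimQuotient μ x r) (𝓝[>] 0) (𝓝 d)

/-- The lower local dimension of `μ` at `x`; it always exists in `[-∞, ∞]`. -/
noncomputable def lowerLocalDim (μ : Measure ℝ) (x : ℝ) : EReal :=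
  liminf (fun r : ℝ => localDimQuotient μ x r) (𝓝[>] 0)

/-- The Bernoulli measure `(p, 1-p)^ℕ` on `{0,1}^ℕ`: the digits are independent, each being `0`
with probability `p` and `1` with probability `1 - p`. -/
noncomputable def bernoulliSeqMeasure (p : unitInterval) : Measure (ℕ → Fin 2) :=
  Measure.infinitePi fun _ : ℕ => ProbabilityTheory.bernoulliMeasure (0 : Fin 2) (1 : Fin 2) p

/-- The natural projection `∑_{n ≥ 1} i_n l^n`. The sequence is indexed from `0` here, so that
`i n` is the coefficient of `l ^ (n + 1)`. -/
noncomputable def natProj (l : ℝ) (i : ℕ → Fin 2) : ℝ :=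
  ∑' n : ℕ, ((i n : ℕ) : ℝ) * l ^ (n + 1)

lemma natProj_summable {l : ℝ} (hl : l ∈ Ioo (0 : ℝ) 1) (i : ℕ → Fin 2) :
    Summable fun n : ℕ => ((i n : ℕ) : ℝ) * l ^ (n + 1) := by
  have hg : Summable fun n : ℕ => l ^ (n + 1) :=
    (summable_nat_add_iff 1).2 (summable_geometric_of_lt_one hl.1.le hl.2)
  refine hg.of_nonneg_of_le (fun n => by have := hl.1; positivity) (fun n => ?_)
  have h1 : ((i n : ℕ) : ℝ) ≤ 1 := by
    have : (i n : ℕ) ≤ 1 := by omega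
    exact_mod_cast this
  have h2 : 0 ≤ l ^ (n + 1) := pow_nonneg hl.1.le _
  nlinarith

lemma measurable_natProj {l : ℝ} (hl : l ∈ Ioo (0 : ℝ) 1) : Measurable (natProj l) := by
  refine measurable_of_tendsto_metrizable
    (f := fun (N : ℕ) (i : ℕ → Fin 2) =>
      ∑ n ∈ Finset.range N, ((i n : ℕ) : ℝ) * l ^ (n + 1)) (fun N => ?_) ?_
  · refine Finset.measurable_sum _ (fun n _ => Measurable.mul_const ?_ _)
    exact (measurable_of_countable fun a : Fin 2 => ((a : ℕ) : ℝ)).comp (measurable_pi_apply n)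
  · rw [tendsto_pi_nhds]
    exact fun i => (natProj_summable hl i).hasSum.tendsto_sum_nat

/-- The `p`-biased Bernoulli convolution with contraction rate `l`: the distribution of
`∑_{n ≥ 1} i_n l^n` for independent digits `i_n` equal to `0` with probability `p` and to `1` with
probability `1 - p`. -/
noncomputable def bernoulliConv (l : ℝ) (p : unitInterval) : Measure ℝ :=
  (bernoulliSeqMeasure p).map (natProj l)

/-- `(0, b)` is an interval of transversality: there is `C > 0` such that for all digit sequences
`i`, `j` with different first digits and all `δ > 0`, the Lebesgue measure of the set of
`l ∈ (0, b)` with `|∑ i_n l^n - ∑ j_n l^n| < δ` is less than `C δ`. -/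
def IsTransversalityInterval (b : ℝ) : Prop :=
  ∃ C : ℝ, 0 < C ∧ ∀ i j : ℕ → Fin 2, i 0 ≠ j 0 → ∀ δ : ℝ, 0 < δ →
    volume {l : ℝ | l ∈ Ioo 0 b ∧ |natProj l i - natProj l j| < δ} < ENNReal.ofReal (C * δ)

/-! Write χ for `weightRate p q`. For `q`-typical `i` the strong law gives the `n`-cylinder of `i` a
`p`-measure of about exp(nχ), and this cylinder projects into an interval of length comparable to `l
^ n`. Small balls therefore contain a cylinder of known weight, and the local dimension is at most χ
/ log l, for every `l` (`ae_eventually_le_ball`).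

The lower bound can fail where cylinders overlap, so it is proved for almost every `l` by
integrating over the parameter. Fix `i`. If `j` first differs from `i` at position `n`,
transversality bounds the measure of the `l` in `(a, b)` with projections `r`-close by C r / a^n,
hence by its power with exponent s ≤ 1. Summing over `n` with the cylinder weights converges as soon
as χ < s log a (`lintegral_closeMeasure_le`). Summing over dyadic `r` and exchanging quantifiers
gives ball measures at most r^s' for every s' < s (`ae_ae_eventually_ball_le`). Letting `a` tend to
`l` gives the lower bound min(1, χ / log l). Since p^q (1-p)^(1-q) = exp χ, the two parts of the
theorem are the two values of this minimum.

For 0.66847 transversality is itself proved: a series 1 + ∑ b_k x^k with coefficients in {-1, 0, 1}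
has no near-double zero there (`tailSeries_transversality`). Up to 0.64 one inequality suffices;
beyond that, a finite search over coefficient prefixes in integer arithmetic is checked by the
kernel. -/

/-! ### Power series with coefficients bounded by 1. -/

/-- The power series `∑_{k ≥ 1} b_{k-1} x^k`. -/
noncomputable def tailSeries (b : ℕ → ℝ) (x : ℝ) : ℝ := ∑' k : ℕ, b k * x ^ (k + 1)

/-- The derivative of `tailSeries b`. -/
noncomputable def tailDeriv (b : ℕ → ℝ) (x : ℝ) : ℝ := ∑' k : ℕ, b k * ((k + 1) * x ^ k)

lemma hasSum_of_eq {f g : ℕ → ℝ} {a : ℝ} (h : HasSum f a) (e : ∀ k, g k = f k) : HasSum g a := by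
  rwa [funext e]

lemma hasSum_geometric_succ {x : ℝ} (hx : x ∈ Ico (0 : ℝ) 1) :
    HasSum (fun k : ℕ => x ^ (k + 1)) (x / (1 - x)) := by
  have h := (hasSum_geometric_of_lt_one hx.1 hx.2).mul_left x
  simpa only [pow_succ', div_eq_mul_inv] using h

lemma hasSum_succ_mul_geometric {x : ℝ} (hx : x ∈ Ico (0 : ℝ) 1) :
    HasSum (fun k : ℕ => ((k : ℝ) + 1) * x ^ k) (1 / (1 - x) ^ 2) := by
  have h := hasSum_choose_mul_geometric_of_norm_lt_one 1 (r := x)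
    (by rw [Real.norm_of_nonneg hx.1]; exact hx.2)
  simpa using h

lemma hasSum_choose_two_mul_geometric {x : ℝ} (hx : x ∈ Ico (0 : ℝ) 1) :
    HasSum (fun k : ℕ => ((k + 2).choose 2 : ℝ) * x ^ k) (1 / (1 - x) ^ 3) :=
  hasSum_choose_mul_geometric_of_norm_lt_one 2 (by rw [Real.norm_of_nonneg hx.1]; exact hx.2)

lemma summable_of_abs_le_one {b : ℕ → ℝ} (hb : ∀ k, |b k| ≤ 1) {a : ℕ → ℝ} (ha : Summable a)
    (h0 : ∀ k, 0 ≤ a k) : Summable fun k => b k * a k := by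
  refine Summable.of_norm_bounded ha (fun k => ?_)
  rw [norm_mul, Real.norm_eq_abs, Real.norm_of_nonneg (h0 k)]
  exact mul_le_of_le_one_left (h0 k) (hb k)

lemma hasSum_tailSeries {b : ℕ → ℝ} (hb : ∀ k, |b k| ≤ 1) {x : ℝ} (hx : x ∈ Ico (0 : ℝ) 1) :
    HasSum (fun k : ℕ => b k * x ^ (k + 1)) (tailSeries b x) :=
  (summable_of_abs_le_one hb (hasSum_geometric_succ hx).summable
    fun _ => pow_nonneg hx.1 _).hasSum

lemma hasSum_tailDeriv {b : ℕ → ℝ} (hb : ∀ k, |b k| ≤ 1) {x : ℝ} (hx : x ∈ Ico (0 : ℝ) 1) :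
    HasSum (fun k : ℕ => b k * ((k + 1) * x ^ k)) (tailDeriv b x) :=
  (summable_of_abs_le_one hb (hasSum_succ_mul_geometric hx).summable
    fun k => mul_nonneg (by positivity) (pow_nonneg hx.1 _)).hasSum

lemma tailSeries_shift {b : ℕ → ℝ} (hb : ∀ k, |b k| ≤ 1) {x : ℝ} (hx : x ∈ Ico (0 : ℝ) 1) :
    tailSeries b x = x * (b 0 + tailSeries (fun k => b (k + 1)) x) := by
  have h := (hasSum_tailSeries (b := fun k => b (k + 1)) (fun k => hb _) hx).mul_left x
  have h2 : HasSum (fun k : ℕ => b (k + 1) * x ^ (k + 1 + 1))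
      (x * tailSeries (fun k => b (k + 1)) x) := by
    refine hasSum_of_eq h fun k => ?_
    ring
  have h3 := h2.zero_add (f := fun k : ℕ => b k * x ^ (k + 1))
  rw [(hasSum_tailSeries hb hx).unique h3]; ring

lemma tailDeriv_shift {b : ℕ → ℝ} (hb : ∀ k, |b k| ≤ 1) {x : ℝ} (hx : x ∈ Ico (0 : ℝ) 1) :
    tailDeriv b x = b 0 + tailSeries (fun k => b (k + 1)) x
      + x * tailDeriv (fun k => b (k + 1)) x := by
  have h := (hasSum_tailDeriv (b := fun k => b (k + 1)) (fun k => hb _) hx).mul_left x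
  have h1 := hasSum_tailSeries (b := fun k => b (k + 1)) (fun k => hb _) hx
  have h2 : HasSum (fun k : ℕ => b (k + 1) * (((k + 1 : ℕ) + 1) * x ^ (k + 1)))
      (tailSeries (fun k => b (k + 1)) x + x * tailDeriv (fun k => b (k + 1)) x) := by
    refine hasSum_of_eq (h1.add h) fun k => ?_
    push_cast; ring
  have h3 := h2.zero_add (f := fun k : ℕ => b k * ((k + 1) * x ^ k))
  rw [(hasSum_tailDeriv hb hx).unique h3]; simp; ring

/-- The value `∑_{k ≥ 1} |m - k| x^k`, computed by recursion on `m`. -/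
noncomputable def absWeight (x : ℝ) : ℕ → ℝ
  | 0 => x / (1 - x) ^ 2
  | m + 1 => x * (m + absWeight x m)

lemma hasSum_absWeight {x : ℝ} (hx : x ∈ Ico (0 : ℝ) 1) (m : ℕ) :
    HasSum (fun k : ℕ => |(m : ℝ) - (k + 1)| * x ^ (k + 1)) (absWeight x m) := by
  induction m with
  | zero =>
    have h := (hasSum_succ_mul_geometric hx).mul_left x
    rw [absWeight, show x / (1 - x) ^ 2 = x * (1 / (1 - x) ^ 2) by ring]
    refine hasSum_of_eq h fun k => ?_
    rw [Nat.cast_zero, zero_sub, abs_neg, abs_of_nonneg (by positivity)]; ring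
  | succ m ih =>
    have h := ih.mul_left x
    have h2 : HasSum (fun k : ℕ => |((m + 1 : ℕ) : ℝ) - ((k + 1 : ℕ) + 1)| * x ^ (k + 1 + 1))
        (x * absWeight x m) := by
      refine hasSum_of_eq h fun k => ?_
      have : ((m + 1 : ℕ) : ℝ) - ((k + 1 : ℕ) + 1) = m - (k + 1) := by push_cast; ring
      rw [this]; ring
    have h3 := h2.zero_add (f := fun k : ℕ => |((m + 1 : ℕ) : ℝ) - (k + 1)| * x ^ (k + 1))
    rw [absWeight]
    convert h3 using 1
    have : |((m + 1 : ℕ) : ℝ) - ((0 : ℕ) + 1)| = m := by push_cast; simp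
    rw [this]; ring

/-- The sharp bound for the functional `m g - x g'` on power series with coefficients bounded
by `1`. -/
lemma abs_functional_le {b : ℕ → ℝ} (hb : ∀ k, |b k| ≤ 1) {x : ℝ} (hx : x ∈ Ico (0 : ℝ) 1)
    (m : ℕ) : |m * tailSeries b x - x * tailDeriv b x| ≤ absWeight x m := by
  have h := ((hasSum_tailSeries hb hx).mul_left (m : ℝ)).sub ((hasSum_tailDeriv hb hx).mul_left x)
  refine h.norm_le_of_bounded (hasSum_absWeight hx m) (fun k => ?_)
  have : (m : ℝ) * (b k * x ^ (k + 1)) - x * (b k * ((k + 1) * x ^ k)) =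
    b k * ((m - (k + 1)) * x ^ (k + 1)) := by ring
  rw [this, Real.norm_eq_abs, abs_mul, abs_mul, abs_of_nonneg (pow_nonneg hx.1 (k + 1))]
  exact mul_le_of_le_one_left (mul_nonneg (abs_nonneg _) (pow_nonneg hx.1 _)) (hb k)

lemma abs_tailSeries_le {b : ℕ → ℝ} (hb : ∀ k, |b k| ≤ 1) {x : ℝ} (hx : x ∈ Ico (0 : ℝ) 1) :
    |tailSeries b x| ≤ x / (1 - x) := by
  refine (hasSum_tailSeries hb hx).norm_le_of_bounded (hasSum_geometric_succ hx) (fun k => ?_)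
  rw [Real.norm_eq_abs, abs_mul, abs_of_nonneg (pow_nonneg hx.1 (k + 1))]
  exact mul_le_of_le_one_left (pow_nonneg hx.1 _) (hb k)

lemma absWeight_mono {x y : ℝ} (hx : 0 ≤ x) (hxy : x ≤ y) (hy : y < 1) (m : ℕ) :
    absWeight x m ≤ absWeight y m := by
  refine hasSum_le (fun k => ?_) (hasSum_absWeight ⟨hx, hxy.trans_lt hy⟩ m)
    (hasSum_absWeight ⟨hx.trans hxy, hy⟩ m)
  gcongr

lemma abs_pow_succ_sub_le {x y r : ℝ} (hx : x ∈ Icc 0 r) (hy : y ∈ Icc 0 r) (k : ℕ) :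
    |y ^ (k + 1) - x ^ (k + 1)| ≤ (k + 1) * r ^ k * |y - x| := by
  induction k with
  | zero => simp
  | succ k ih =>
    have h : y ^ (k + 1 + 1) - x ^ (k + 1 + 1) =
        y * (y ^ (k + 1) - x ^ (k + 1)) + x ^ (k + 1) * (y - x) := by ring
    rw [h]
    refine (abs_add_le _ _).trans ?_
    rw [abs_mul, abs_mul, abs_of_nonneg hy.1, abs_of_nonneg (pow_nonneg hx.1 _)]
    have h1 : y * |y ^ (k + 1) - x ^ (k + 1)| ≤ r * ((k + 1) * r ^ k * |y - x|) :=
      mul_le_mul hy.2 ih (abs_nonneg _) (hy.1.trans hy.2)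
    have h2 : x ^ (k + 1) * |y - x| ≤ r ^ (k + 1) * |y - x| := by
      have := pow_le_pow_left₀ hx.1 hx.2 (k + 1); gcongr
    push_cast
    calc _ ≤ r * ((k + 1) * r ^ k * |y - x|) + r ^ (k + 1) * |y - x| := add_le_add h1 h2
      _ = _ := by ring

lemma abs_pow_taylor_le {x y r : ℝ} (hx : x ∈ Icc 0 r) (hy : y ∈ Icc 0 r) (k : ℕ) :
    |y ^ (k + 2) - x ^ (k + 2) - (k + 2) * x ^ (k + 1) * (y - x)| ≤
      (k + 2).choose 2 * r ^ k * (y - x) ^ 2 := by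
  induction k with
  | zero =>
    have : y ^ (0 + 2) - x ^ (0 + 2) - ((0 : ℕ) + 2) * x ^ (0 + 1) * (y - x) = (y - x) ^ 2 := by
      simp; ring
    rw [this, abs_of_nonneg (sq_nonneg _)]; simp
  | succ k ih =>
    have h : y ^ (k + 1 + 2) - x ^ (k + 1 + 2) - ((k + 1 : ℕ) + 2) * x ^ (k + 1 + 1) * (y - x) =
        y * (y ^ (k + 2) - x ^ (k + 2) - (k + 2) * x ^ (k + 1) * (y - x)) +
          (k + 2) * x ^ (k + 1) * (y - x) ^ 2 := by push_cast; ring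
    rw [h]
    refine (abs_add_le _ _).trans ?_
    have hk : (0 : ℝ) ≤ (k + 2) * x ^ (k + 1) * (y - x) ^ 2 := by
      have := hx.1; positivity
    rw [abs_mul, abs_of_nonneg hy.1, abs_of_nonneg hk]
    have h1 := mul_le_mul hy.2 ih (abs_nonneg _) (hy.1.trans hy.2)
    have h2 : (k + 2) * x ^ (k + 1) * (y - x) ^ 2 ≤ (k + 2) * r ^ (k + 1) * (y - x) ^ 2 := by
      have := pow_le_pow_left₀ hx.1 hx.2 (k + 1); gcongr
    have h3 : ((k + 1 + 2).choose 2 : ℝ) = (k + 2) + (k + 2).choose 2 := by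
      rw [show k + 1 + 2 = (k + 2) + 1 from rfl, Nat.choose_succ_succ' (k + 2) 1]; simp
    rw [h3]
    calc _ ≤ r * ((k + 2).choose 2 * r ^ k * (y - x) ^ 2)
          + (k + 2) * r ^ (k + 1) * (y - x) ^ 2 := add_le_add h1 h2
      _ = _ := by ring

/-- The termwise remainders are dominated by a binomial series, so the constant is uniform over all
coefficient sequences; that uniformity is what transversality needs. -/
lemma abs_tailSeries_taylor_le {b : ℕ → ℝ} (hb : ∀ k, |b k| ≤ 1) {x y r : ℝ} (hr : r < 1)
    (hx : x ∈ Icc 0 r) (hy : y ∈ Icc 0 r) :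
    |tailSeries b y - tailSeries b x - tailDeriv b x * (y - x)| ≤
      1 / (1 - r) ^ 3 * (y - x) ^ 2 := by
  have hx' : x ∈ Ico (0 : ℝ) 1 := ⟨hx.1, hx.2.trans_lt hr⟩
  have hy' : y ∈ Ico (0 : ℝ) 1 := ⟨hy.1, hy.2.trans_lt hr⟩
  have h := ((hasSum_tailSeries hb hy').sub (hasSum_tailSeries hb hx')).sub
    ((hasSum_tailDeriv hb hx').mul_right (y - x))
  have hc := ((hasSum_choose_two_mul_geometric ⟨hx.1.trans hx.2, hr⟩).mul_right ((y - x) ^ 2))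
  -- Index shift: the term `k = 0` vanishes because `Nat.choose 1 2 = 0`, so the truncated `k - 1`
  -- there is harmless.
  have hc' : HasSum (fun k : ℕ => ((k + 1).choose 2 : ℝ) * r ^ (k - 1) * (y - x) ^ 2)
      (1 / (1 - r) ^ 3 * (y - x) ^ 2) := by
    have := HasSum.zero_add (f := fun k : ℕ => ((k + 1).choose 2 : ℝ) * r ^ (k - 1) * (y - x) ^ 2)
      hc
    simpa using this
  refine h.norm_le_of_bounded hc' (fun k => ?_)
  have he : b k * y ^ (k + 1) - b k * x ^ (k + 1) - b k * ((k + 1) * x ^ k) * (y - x) =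
      b k * (y ^ (k + 1) - x ^ (k + 1) - (k + 1) * x ^ k * (y - x)) := by ring
  rw [he, Real.norm_eq_abs, abs_mul]
  refine (mul_le_of_le_one_left (abs_nonneg _) (hb k)).trans ?_
  cases k with
  | zero => simp
  | succ k =>
    have := abs_pow_taylor_le hx hy k
    push_cast
    rw [show (k : ℝ) + 1 + 1 = k + 2 by ring]
    exact this

lemma abs_tailDeriv_sub_le {b : ℕ → ℝ} (hb : ∀ k, |b k| ≤ 1) {x y r : ℝ} (hr : r < 1)
    (hx : x ∈ Icc 0 r) (hy : y ∈ Icc 0 r) :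
    |y * tailDeriv b y - x * tailDeriv b x| ≤ 2 / (1 - r) ^ 3 * |y - x| := by
  have hx' : x ∈ Ico (0 : ℝ) 1 := ⟨hx.1, hx.2.trans_lt hr⟩
  have hy' : y ∈ Ico (0 : ℝ) 1 := ⟨hy.1, hy.2.trans_lt hr⟩
  have h := ((hasSum_tailDeriv hb hy').mul_left y).sub ((hasSum_tailDeriv hb hx').mul_left x)
  have hc := ((hasSum_choose_two_mul_geometric ⟨hx.1.trans hx.2, hr⟩).mul_left 2).mul_right |y - x|
  rw [show 2 / (1 - r) ^ 3 * |y - x| = 2 * (1 / (1 - r) ^ 3) * |y - x| by ring]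
  refine h.norm_le_of_bounded hc (fun k => ?_)
  have he : y * (b k * ((k + 1) * y ^ k)) - x * (b k * ((k + 1) * x ^ k)) =
      b k * ((k + 1) * (y ^ (k + 1) - x ^ (k + 1))) := by ring
  rw [he, Real.norm_eq_abs, abs_mul]
  refine (mul_le_of_le_one_left (abs_nonneg _) (hb k)).trans ?_
  rw [abs_mul, abs_of_nonneg (by positivity : (0 : ℝ) ≤ (k : ℝ) + 1)]
  have h1 := mul_le_mul_of_nonneg_left (abs_pow_succ_sub_le hx hy k)
    (by positivity : (0 : ℝ) ≤ (k : ℝ) + 1)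
  refine h1.trans ?_
  have h2 : ((k + 2).choose 2 : ℝ) = (k + 2) * (k + 1) / 2 := by
    rw [Nat.cast_choose_two]; push_cast; ring
  rw [h2]
  have h3 : 0 ≤ r ^ k * |y - x| := mul_nonneg (pow_nonneg (hx.1.trans hx.2) _) (abs_nonneg _)
  have hk : (0 : ℝ) ≤ k := Nat.cast_nonneg k
  nlinarith [mul_nonneg hk h3]

/-! ### Exclusion of double zeros by a finite search. -/

/-- Sufficient condition for a double zero at `A / B` to be impossible. The integers `U / q` and
`W / q` are the normalised values of the prefix and of its derivative, up to errors `E / q` and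
`F / q`. -/
def noDoubleZero (A B q U W E F : ℤ) : Bool :=
  decide (q * A + E * (B - A) < |U| * (B - A)) ||
  decide (q * A ^ 2 + (E + F) * (B - A) ^ 2 < |U - W| * (B - A) ^ 2) ||
  decide (q * (A * ((B - A) ^ 2 + A ^ 2)) + (2 * E + F) * (B * (B - A) ^ 2) <
    |2 * U - W| * (B * (B - A) ^ 2)) ||
  decide (q * (A * (2 * B * (B - A) ^ 2 + A * ((B - A) ^ 2 + A ^ 2))) +
    (3 * E + F) * (B ^ 2 * (B - A) ^ 2) < |3 * U - W| * (B ^ 2 * (B - A) ^ 2))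

/-- Depth-first search over the possible coefficients `-1, 0, 1`, where every branch has to be
closed by `noDoubleZero`. -/
def excludesDoubleZero (A B : ℤ) : ℕ → ℤ → ℤ → ℤ → ℤ → ℤ → Bool
  | 0, q, U, W, E, F => noDoubleZero A B q U W E F
  | n + 1, q, U, W, E, F => noDoubleZero A B q U W E F ||
    (excludesDoubleZero A B n (A * q) (B * U - A * q) (B * (W - U)) (B * E) (B * (E + F)) &&
      excludesDoubleZero A B n (A * q) (B * U) (B * (W - U)) (B * E) (B * (E + F)) &&
      excludesDoubleZero A B n (A * q) (B * U + A * q) (B * (W - U)) (B * E) (B * (E + F)))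

lemma abs_le_one_of_mem {b : ℕ → ℝ} (hb : ∀ k, b k = -1 ∨ b k = 0 ∨ b k = 1) (k : ℕ) :
    |b k| ≤ 1 := by
  rcases hb k with h | h | h <;> simp [h]

/-- When prefix and tail nearly cancel, both in value and in derivative, the functional of the
prefix equals that of the tail up to sign and error. The combination `m g - x g'` removes the
coefficient of `x ^ m`, which makes its bound on the tail small. -/
lemma functional_bound {b : ℕ → ℝ} (hb : ∀ k, |b k| ≤ 1) {x : ℝ} (hx : x ∈ Ico (0 : ℝ) 1) (m : ℕ)
    {q U W E F : ℝ} (hq : 0 ≤ q) (h1 : |U + q * tailSeries b x| ≤ E)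
    (h2 : |W + q * (x * tailDeriv b x)| ≤ F) :
    |m * U - W| ≤ q * absWeight x m + (m * E + F) := by
  have h3 := abs_functional_le hb hx m
  have hm : (0 : ℝ) ≤ m := Nat.cast_nonneg m
  have h4 := mul_le_mul_of_nonneg_left h3 hq
  have h5 := mul_le_mul_of_nonneg_left h1 hm
  rw [← abs_of_nonneg hm, ← abs_mul, abs_of_nonneg hm] at h5
  rw [← abs_of_nonneg hq, ← abs_mul, abs_of_nonneg hq] at h4
  have : m * U - W = m * (U + q * tailSeries b x) - (W + q * (x * tailDeriv b x)) -
    q * (m * tailSeries b x - x * tailDeriv b x) := by ring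
  rw [this]
  refine (abs_sub _ _).trans ?_
  have := abs_sub (m * (U + q * tailSeries b x)) (W + q * (x * tailDeriv b x))
  linarith

lemma noDoubleZero_sound {A B : ℤ} (hA : 0 < A) (hAB : A < B) {b : ℕ → ℝ} (hb : ∀ k, |b k| ≤ 1)
    {q U W E F : ℤ} (hq : 0 ≤ q)
    (h1 : |(U : ℝ) + q * tailSeries b (A / B)| ≤ E)
    (h2 : |(W : ℝ) + q * ((A / B : ℝ) * tailDeriv b (A / B))| ≤ F) :
    noDoubleZero A B q U W E F = false := by
  have hA' : (0 : ℝ) < A := by exact_mod_cast hA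
  have hAB' : (0 : ℝ) < B - A := by rw [sub_pos]; exact_mod_cast hAB
  have hB' : (0 : ℝ) < B := by linarith
  have hq' : (0 : ℝ) ≤ q := by exact_mod_cast hq
  have hx : (A / B : ℝ) ∈ Ico (0 : ℝ) 1 := ⟨by positivity, (div_lt_one hB').2 (by linarith)⟩
  have e0 : (1 : ℝ) - A / B = (B - A) / B := by field_simp
  have f0 := functional_bound hb hx 1 hq' h1 h2
  have f1 := functional_bound hb hx 2 hq' h1 h2
  have f2 := functional_bound hb hx 3 hq' h1 h2
  have hne : (B : ℝ) - A ≠ 0 := hAB'.ne'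
  simp only [absWeight, e0] at f0 f1 f2
  have fi : |(U : ℝ)| ≤ q * (A / (B - A)) + E := by
    have h3 := abs_tailSeries_le hb hx
    rw [e0, show (A / B : ℝ) / ((B - A) / B) = A / (B - A) by field_simp] at h3
    have h4 := mul_le_mul_of_nonneg_left h3 hq'
    rw [← abs_of_nonneg hq', ← abs_mul, abs_of_nonneg hq'] at h4
    have : (U : ℝ) = (U + q * tailSeries b (A / B)) - q * tailSeries b (A / B) := by ring
    rw [this]
    exact (abs_sub _ _).trans (by linarith)
  simp only [noDoubleZero, Bool.or_eq_false_iff, decide_eq_false_iff_not, not_lt]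
  refine ⟨⟨⟨?_, ?_⟩, ?_⟩, ?_⟩
  · have h := mul_le_mul_of_nonneg_right fi hAB'.le
    have e : (q * (A / (B - A)) + E : ℝ) * (B - A) = q * A + E * (B - A) := by field_simp
    rw [e] at h
    exact_mod_cast h
  · have h := mul_le_mul_of_nonneg_right f0 (sq_nonneg (B - A : ℝ))
    have e : ((q : ℝ) * (A / B * ((0 : ℕ) + A / B / ((B - A) / B) ^ 2)) + ((1 : ℕ) * E + F)) *
        (B - A) ^ 2 = q * A ^ 2 + (E + F) * (B - A) ^ 2 := by field_simp; push_cast; ring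
    rw [e, Nat.cast_one, one_mul] at h
    exact_mod_cast h
  · have h := mul_le_mul_of_nonneg_right f1 (mul_nonneg hB'.le (sq_nonneg (B - A : ℝ)))
    have e : ((q : ℝ) * (A / B * ((1 : ℕ) + A / B * ((0 : ℕ) + A / B / ((B - A) / B) ^ 2))) +
        ((2 : ℕ) * E + F)) * (B * (B - A) ^ 2) =
        q * (A * ((B - A) ^ 2 + A ^ 2)) + (2 * E + F) * (B * (B - A) ^ 2) := by
      field_simp; push_cast; ring
    rw [e, Nat.cast_ofNat] at h
    rw [← Int.cast_le (R := ℝ)]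
    push_cast
    exact h
  · have h := mul_le_mul_of_nonneg_right f2 (mul_nonneg (sq_nonneg (B : ℝ)) (sq_nonneg (B - A : ℝ)))
    have e : ((q : ℝ) * (A / B * ((2 : ℕ) + A / B * ((1 : ℕ) + A / B * ((0 : ℕ) +
        A / B / ((B - A) / B) ^ 2)))) + ((3 : ℕ) * E + F)) * (B ^ 2 * (B - A) ^ 2) =
        q * (A * (2 * B * (B - A) ^ 2 + A * ((B - A) ^ 2 + A ^ 2))) +
          (3 * E + F) * (B ^ 2 * (B - A) ^ 2) := by
      field_simp; push_cast; ring
    rw [e, Nat.cast_ofNat] at h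
    rw [← Int.cast_le (R := ℝ)]
    push_cast
    exact h

/-- Each search step moves the coefficient `b 0` from the tail into the prefix, divides by `x = A /
B`, and clears the denominator by rescaling. A real near-double zero follows one branch down to a
leaf, and no test on that branch can succeed. -/
lemma excludesDoubleZero_sound {A B : ℤ} (hA : 0 < A) (hAB : A < B) (n : ℕ) {b : ℕ → ℝ}
    (hb : ∀ k, b k = -1 ∨ b k = 0 ∨ b k = 1) {q U W E F : ℤ} (hq : 0 ≤ q)
    (h1 : |(U : ℝ) + q * tailSeries b (A / B)| ≤ E)
    (h2 : |(W : ℝ) + q * ((A / B : ℝ) * tailDeriv b (A / B))| ≤ F) :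
    excludesDoubleZero A B n q U W E F = false := by
  induction n generalizing b q U W E F with
  | zero => exact noDoubleZero_sound hA hAB (abs_le_one_of_mem hb) hq h1 h2
  | succ n ih =>
    have hA' : (0 : ℝ) < A := by exact_mod_cast hA
    have hB' : (0 : ℝ) < B := by exact_mod_cast hA.trans hAB
    have hx : (A / B : ℝ) ∈ Ico (0 : ℝ) 1 :=
      ⟨by positivity, (div_lt_one hB').2 (by exact_mod_cast hAB)⟩
    have hb1 := abs_le_one_of_mem hb
    have key : ∀ V : ℤ, (V : ℝ) = B * U + b 0 * (A * q) →
        excludesDoubleZero A B n (A * q) V (B * (W - U)) (B * E) (B * (E + F)) = false := by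
      intro V hV
      refine ih (b := fun k => b (k + 1)) (fun k => hb _) (by positivity) ?_ ?_
      · have e : (V : ℝ) + (A * q : ℤ) * tailSeries (fun k => b (k + 1)) (A / B) =
            B * (U + q * tailSeries b (A / B)) := by
          rw [tailSeries_shift hb1 hx, hV]; push_cast; field_simp; ring
        rw [e, abs_mul, abs_of_pos hB']; push_cast
        exact mul_le_mul_of_nonneg_left h1 hB'.le
      -- Dividing by `x` lowers every exponent by one, so the new `x g'` is the old one minus the
      -- old value: hence `W - U`, with error `E + F`.
      · have e : ((B * (W - U) : ℤ) : ℝ) +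
            (A * q : ℤ) * ((A / B : ℝ) * tailDeriv (fun k => b (k + 1)) (A / B)) =
            B * ((W + q * ((A / B : ℝ) * tailDeriv b (A / B))) -
              (U + q * tailSeries b (A / B))) := by
          rw [tailDeriv_shift hb1 hx, tailSeries_shift hb1 hx]; push_cast; field_simp; ring
        rw [e, abs_mul, abs_of_pos hB']; push_cast
        refine mul_le_mul_of_nonneg_left ((abs_sub _ _).trans ?_) hB'.le
        linarith
    rw [excludesDoubleZero, noDoubleZero_sound hA hAB hb1 hq h1 h2, Bool.false_or]
    rcases hb 0 with h | h | h
    · rw [key (B * U - A * q) (by rw [h]; push_cast; ring)]; simp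
    · rw [key (B * U) (by rw [h]; push_cast; ring)]; simp
    · rw [key (B * U + A * q) (by rw [h]; push_cast; ring)]; simp

/-- The search for an interval with centre `A / 10 ^ 7` and radius `H / 10 ^ 7`. -/
def searchInterval (A H : ℤ) : Bool :=
  excludesDoubleZero A (10 ^ 7) 30 (10 ^ 16) (10 ^ 16) 0 (2800 * H ^ 2 + 2 * 10 ^ 7)
    (55 * H * 10 ^ 9 + 10 ^ 7)

/-- A near-double zero at `x` is carried to the centre of the interval by Taylor expansion. As the
derivative at `x` is tiny, the value at the centre is off only quadratically in `H`; the derivative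
is off linearly. -/
lemma tailDeriv_ge_of_searchInterval {A H : ℤ} (hA : 0 < A) (hH : 0 ≤ H) (hAH : A + H ≤ 6685000)
    (hH2 : H ≤ 10 ^ 6)
    (hs : searchInterval A H = true) {b : ℕ → ℝ} (hb : ∀ k, b k = -1 ∨ b k = 0 ∨ b k = 1)
    {x : ℝ} (hx0 : 1 / 2 ≤ x) (hx : |x - (A : ℝ) / 10 ^ 7| ≤ (H : ℝ) / 10 ^ 7)
    (h1 : |1 + tailSeries b x| < 1 / 10 ^ 9) : 1 / 10 ^ 9 ≤ |x * tailDeriv b x| := by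
  by_contra! h2
  have hA' : (0 : ℝ) < A := by exact_mod_cast hA
  have hH' : (0 : ℝ) ≤ H := by exact_mod_cast hH
  have hH2' : (H : ℝ) ≤ 10 ^ 6 := by exact_mod_cast hH2
  have hAH' : (A : ℝ) + H ≤ 6685000 := by exact_mod_cast hAH
  have hb1 := abs_le_one_of_mem hb
  set y : ℝ := A / 10 ^ 7 with hy
  have hxI : x ∈ Icc (0 : ℝ) 0.6685 := by
    have := (abs_le.1 hx).2
    constructor
    · linarith
    · norm_num at *; linarith
  have hyI : y ∈ Icc (0 : ℝ) 0.6685 := by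
    constructor
    · positivity
    · rw [hy, div_le_iff₀ (by norm_num)]; norm_num; linarith
  have t1 := abs_tailSeries_taylor_le hb1 (by norm_num : (0.6685 : ℝ) < 1) hxI hyI
  have t2 := abs_tailDeriv_sub_le hb1 (by norm_num : (0.6685 : ℝ) < 1) hxI hyI
  rw [abs_sub_comm] at hx
  have hd : |tailDeriv b x| ≤ 2 / 10 ^ 9 := by
    rw [abs_mul, abs_of_nonneg hxI.1] at h2
    nlinarith [abs_nonneg (tailDeriv b x)]
  have hsq : (y - x) ^ 2 ≤ (H / 10 ^ 7) ^ 2 := by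
    rw [← sq_abs (y - x)]; exact pow_le_pow_left₀ (abs_nonneg _) hx 2
  have g1 : |1 + tailSeries b y| ≤ 1 / 10 ^ 9 + 2 / 10 ^ 9 * (H / 10 ^ 7) +
      28 * (H / 10 ^ 7) ^ 2 := by
    have e : 1 + tailSeries b y = (1 + tailSeries b x) + tailDeriv b x * (y - x) +
      (tailSeries b y - tailSeries b x - tailDeriv b x * (y - x)) := by ring
    rw [e]
    have a1 := abs_add_le ((1 + tailSeries b x) + tailDeriv b x * (y - x))
      (tailSeries b y - tailSeries b x - tailDeriv b x * (y - x))
    have a2 := abs_add_le (1 + tailSeries b x) (tailDeriv b x * (y - x))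
    have a3 : |tailDeriv b x * (y - x)| ≤ 2 / 10 ^ 9 * (H / 10 ^ 7) := by
      rw [abs_mul]; exact mul_le_mul hd hx (abs_nonneg _) (by positivity)
    have a4 : 1 / (1 - 0.6685) ^ 3 * (y - x) ^ 2 ≤ 28 * (H / 10 ^ 7) ^ 2 :=
      mul_le_mul (by norm_num) hsq (sq_nonneg _) (by norm_num)
    linarith
  have g2 : |y * tailDeriv b y| ≤ 1 / 10 ^ 9 + 55 * (H / 10 ^ 7) := by
    have e : y * tailDeriv b y = x * tailDeriv b x +
      (y * tailDeriv b y - x * tailDeriv b x) := by ring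
    rw [e]
    have a1 := abs_add_le (x * tailDeriv b x) (y * tailDeriv b y - x * tailDeriv b x)
    have a4 : 2 / (1 - 0.6685) ^ 3 * |y - x| ≤ 55 * (H / 10 ^ 7) :=
      mul_le_mul (by norm_num) hx (abs_nonneg _) (by norm_num)
    linarith
  have hB : ((10 ^ 7 : ℤ) : ℝ) = 10 ^ 7 := by norm_num
  have hAB : A < 10 ^ 7 := by linarith
  -- `E` and `F` are the bounds `g1` and `g2` times `10 ^ 16`; in `E` the terms `10 ^ 7 + 2 * H` are
  -- absorbed into `2 * 10 ^ 7` using `H ≤ 10 ^ 6`.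
  have := excludesDoubleZero_sound hA hAB 30 hb (q := 10 ^ 16) (U := 10 ^ 16) (W := 0)
    (E := 2800 * H ^ 2 + 2 * 10 ^ 7) (F := 55 * H * 10 ^ 9 + 10 ^ 7) (by norm_num)
    (by
      rw [hB, ← hy]
      have : ((10 ^ 16 : ℤ) : ℝ) + (10 ^ 16 : ℤ) * tailSeries b y =
        10 ^ 16 * (1 + tailSeries b y) := by push_cast; ring
      rw [this, abs_mul, abs_of_pos (by norm_num : (0 : ℝ) < 10 ^ 16)]
      push_cast
      linarith)
    (by
      rw [hB, ← hy]
      have : ((0 : ℤ) : ℝ) + (10 ^ 16 : ℤ) * (y * tailDeriv b y) =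
        10 ^ 16 * (y * tailDeriv b y) := by push_cast; ring
      rw [this, abs_mul, abs_of_pos (by norm_num : (0 : ℝ) < 10 ^ 16)]
      push_cast
      linarith)
  rw [searchInterval, this] at hs
  exact absurd hs (by decide)

/-- The search over the consecutive intervals with left end `t / 10 ^ 7` and the given radii, which
have to cover everything up to `0.66847`. -/
def searchCover (t : ℤ) : List ℤ → Bool
  | [] => decide (6684700 < t)
  | H :: L => decide (0 ≤ H) && decide (H ≤ 10 ^ 6) && decide (t + 2 * H ≤ 6685000) &&
    searchInterval (t + H) H && searchCover (t + 2 * H) L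

lemma tailDeriv_ge_of_searchCover {L : List ℤ} {t : ℤ} (ht : 5000000 ≤ t)
    (hs : searchCover t L = true) {b : ℕ → ℝ} (hb : ∀ k, b k = -1 ∨ b k = 0 ∨ b k = 1)
    {x : ℝ} (hx0 : (t : ℝ) / 10 ^ 7 ≤ x) (hx : x ≤ 0.66847)
    (h1 : |1 + tailSeries b x| < 1 / 10 ^ 9) : 1 / 10 ^ 9 ≤ |x * tailDeriv b x| := by
  induction L generalizing t with
  | nil =>
    have h : 6684700 < t := by simpa [searchCover] using hs
    have h' : (6684700 : ℝ) < t := by exact_mod_cast h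
    norm_num at *
    linarith
  | cons H L ih =>
    simp only [searchCover, Bool.and_eq_true, decide_eq_true_eq] at hs
    obtain ⟨⟨⟨⟨h0, h6⟩, h3⟩, h4⟩, h5⟩ := hs
    rcases le_or_gt ((t + 2 * H : ℤ) / 10 ^ 7 : ℝ) x with h | h
    · exact ih (by linarith) h5 h
    · have ht' : (5000000 : ℝ) ≤ t := by exact_mod_cast ht
      refine tailDeriv_ge_of_searchInterval (A := t + H) (by linarith) h0 (by linarith) h6 h4 hb
        (by linarith) ?_ h1
      push_cast at h ⊢
      rw [abs_le]
      constructor <;> linarith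

/-- Twice the sum of the radii is 284704, so the cover runs from 0.64 to 0.6684704, just past
0.66847. The radii shrink towards the right end. -/
lemma searchCover_eq_true : searchCover 6400000 [53857, 38391, 23222, 12763, 6722, 3535, 1847, 968,
    508, 266, 140, 75, 38, 20] = true := by
  decide +kernel

/-- Uniform transversality for power series `1 + ∑_{k ≥ 1} b_k x^k` with coefficients in
`{-1, 0, 1}` on `(0, 0.66847)`. -/
lemma tailSeries_transversality {b : ℕ → ℝ} (hb : ∀ k, b k = -1 ∨ b k = 0 ∨ b k = 1)
    {x : ℝ} (hx0 : 0 ≤ x) (hx : x ≤ 0.66847) (h1 : |1 + tailSeries b x| < 1 / 10 ^ 9) :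
    1 / 10 ^ 9 ≤ |x * tailDeriv b x| := by
  rcases le_total x 0.64 with hx' | hx'
  · by_contra! h2
    -- The constant term 1 alone gives the functional with `m = 4` the value 4, while `absWeight
    -- 0.64 4` is about 3.83.
    have h3 := functional_bound (q := 1) (U := 1) (W := 0) (abs_le_one_of_mem hb)
      ⟨hx0, by linarith⟩ 4 zero_le_one (by simpa using h1.le) (by simpa using h2.le)
    have h4 := absWeight_mono hx0 hx' (by norm_num) 4
    norm_num [absWeight] at h3 h4
    linarith
  · exact tailDeriv_ge_of_searchCover (by norm_num) searchCover_eq_true hb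
      (by norm_num at *; linarith) hx h1

/-! ### From the derivative bound to transversality on (0, 0.66847). -/

/-- Cut the unit interval into `N` pieces of length `1 / N`; the part of `S` in each piece has
diameter at most `d`. -/
lemma volume_le_of_forall_close {S : Set ℝ} (hS : S ⊆ Ico 0 1) {N : ℕ} (hN : 0 < N) {d : ℝ}
    (h : ∀ x ∈ S, ∀ y ∈ S, |x - y| ≤ 1 / N → |x - y| ≤ d) :
    volume S ≤ N * ENNReal.ofReal d := by
  have hN' : (0 : ℝ) < N := by exact_mod_cast hN
  have hcov : S ⊆ ⋃ m ∈ Finset.range N, S ∩ {x | ⌊x * N⌋₊ = m} := by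
    intro x hx
    simp only [mem_iUnion, Finset.mem_range]
    refine ⟨⌊x * N⌋₊, ?_, hx, rfl⟩
    rw [Nat.floor_lt (mul_nonneg (hS hx).1 hN'.le)]
    nlinarith [(hS hx).2]
  refine (measure_mono hcov).trans ((measure_biUnion_finset_le _ _).trans ?_)
  have hpiece : ∀ m ∈ Finset.range N, volume (S ∩ {x | ⌊x * N⌋₊ = m}) ≤ ENNReal.ofReal d := by
    intro m _
    refine (Real.volume_le_diam _).trans (Metric.ediam_le fun x hx y hy => ?_)
    rw [edist_dist, Real.dist_eq]
    refine ENNReal.ofReal_le_ofReal (h x hx.1 y hy.1 ?_)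
    have bounds : ∀ z ∈ S ∩ {x | ⌊x * N⌋₊ = m}, (m : ℝ) ≤ z * N ∧ z * N < m + 1 := by
      intro z hz
      have h0 := mul_nonneg (hS hz.1).1 hN'.le
      rw [← hz.2]
      exact ⟨Nat.floor_le h0, Nat.lt_floor_add_one _⟩
    have hx' := bounds x hx
    have hy' := bounds y hy
    rw [le_div_iff₀ hN', ← abs_of_pos hN', ← abs_mul, abs_le]
    constructor <;> nlinarith
  refine (Finset.sum_le_sum hpiece).trans ?_
  simp

lemma natProj_sub_eq {l : ℝ} (hl : l ∈ Ioo (0 : ℝ) 1) {i j : ℕ → Fin 2} (hi : i 0 = 1)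
    (hj : j 0 = 0) : natProj l i - natProj l j =
      l * (1 + tailSeries (fun k => ((i (k + 1) : ℕ) : ℝ) - ((j (k + 1) : ℕ) : ℝ)) l) := by
  have h := (natProj_summable hl i).hasSum.sub (natProj_summable hl j).hasSum
  have hb : ∀ k, |((i k : ℕ) : ℝ) - ((j k : ℕ) : ℝ)| ≤ 1 := by
    intro k
    generalize i k = a
    generalize j k = c
    fin_cases a <;> fin_cases c <;> simp
  have h2 := hasSum_tailSeries hb ⟨hl.1.le, hl.2⟩
  have h3 : natProj l i - natProj l j =
      tailSeries (fun k => ((i k : ℕ) : ℝ) - ((j k : ℕ) : ℝ)) l :=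
    h.unique (hasSum_of_eq h2 fun k => by ring)
  rw [h3, tailSeries_shift hb ⟨hl.1.le, hl.2⟩, hi, hj]
  simp

lemma volume_natProj_sub_lt {i j : ℕ → Fin 2} (hi : i 0 = 1) (hj : j 0 = 0) {δ : ℝ} (hδ : 0 < δ) :
    volume {l : ℝ | l ∈ Ioo 0 0.66847 ∧ |natProj l i - natProj l j| < δ} ≤
      ENNReal.ofReal (2 * δ) +
        (56 * 10 ^ 9 : ℕ) * ENNReal.ofReal (12 * 10 ^ 9 * δ) := by
  set b : ℕ → ℝ := fun k => ((i (k + 1) : ℕ) : ℝ) - ((j (k + 1) : ℕ) : ℝ) with hbdef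
  have hb : ∀ k, b k = -1 ∨ b k = 0 ∨ b k = 1 := by
    intro k
    simp only [hbdef]
    generalize i (k + 1) = a
    generalize j (k + 1) = c
    fin_cases a <;> fin_cases c <;> simp
  have hb1 := abs_le_one_of_mem hb
  have heq : ∀ l ∈ Ioo (0 : ℝ) 0.66847, |natProj l i - natProj l j| =
      l * |1 + tailSeries b l| := by
    intro l hl
    rw [natProj_sub_eq ⟨hl.1, by have := hl.2; norm_num at *; linarith⟩ hi hj, abs_mul,
      abs_of_pos hl.1]
  set S : Set ℝ := {l | l ∈ Ico (1 / 3 : ℝ) 0.66847 ∧ |1 + tailSeries b l| < 3 * δ} with hSdef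
  have hsub : {l : ℝ | l ∈ Ioo 0 0.66847 ∧ |natProj l i - natProj l j| < δ} ⊆
      Ioo 0 (2 * δ) ∪ S := by
    rintro l ⟨hl, h⟩
    rw [heq l hl] at h
    -- Below 1/3 the tail is at most 1/2 in absolute value, so the difference of projections is at
    -- least `l / 2`. From 1/3 on, the factor `l` costs only the constant 3.
    rcases lt_or_ge l (1 / 3) with h3 | h3
    · left
      refine ⟨hl.1, ?_⟩
      have h1 := abs_tailSeries_le hb1 (x := l) ⟨hl.1.le, by linarith⟩
      have h2 : l / (1 - l) ≤ 1 / 2 := by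
        rw [div_le_iff₀ (by linarith)]; linarith
      have h4 : 1 / 2 ≤ |1 + tailSeries b l| := by
        refine le_trans ?_ (le_abs_self _)
        linarith [(abs_le.1 (h1.trans h2)).1]
      nlinarith [hl.1]
    · right
      refine ⟨⟨h3, hl.2⟩, ?_⟩
      nlinarith [abs_nonneg (1 + tailSeries b l)]
  refine (measure_mono hsub).trans ((measure_union_le _ _).trans ?_)
  refine add_le_add (by rw [Real.volume_Ioo, sub_zero]) ?_
  refine volume_le_of_forall_close (fun l hl => ⟨by linarith [hl.1.1], hl.1.2.trans (by norm_num)⟩)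
    (by norm_num) (fun x hx y hy hxy => ?_)
  rw [abs_sub_comm] at hxy ⊢
  have hx2 := hx.1.2
  have hy2 := hy.1.2
  have hx1 := hx.1.1
  have hy1 := hy.1.1
  -- For large `δ` the claimed bound exceeds 1 and is trivial.
  rcases le_or_gt (1 / 10 ^ 9) (3 * δ) with hd | hd
  · have : |y - x| ≤ 1 := hxy.trans (by norm_num)
    norm_num at hd ⊢
    linarith
  · have h1 := tailSeries_transversality hb (by linarith) hx2.le (hx.2.trans hd)
    have h2 := abs_tailSeries_taylor_le hb1 (r := 0.66847) (x := x) (y := y) (by norm_num)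
      ⟨by linarith, hx2.le⟩ ⟨by linarith, hy2.le⟩
    have h3 : 1 / 10 ^ 9 ≤ |tailDeriv b x| := by
      rw [abs_mul, abs_of_nonneg (by linarith : 0 ≤ x)] at h1
      refine h1.trans (mul_le_of_le_one_left (abs_nonneg _) ?_)
      norm_num at hx2; linarith
    have h4 : |tailDeriv b x * (y - x)| ≤ 6 * δ + 28 * |y - x| ^ 2 := by
      have e : tailDeriv b x * (y - x) = (1 + tailSeries b y) - (1 + tailSeries b x) -
        (tailSeries b y - tailSeries b x - tailDeriv b x * (y - x)) := by ring
      rw [e]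
      have a1 := abs_sub ((1 + tailSeries b y) - (1 + tailSeries b x))
        (tailSeries b y - tailSeries b x - tailDeriv b x * (y - x))
      have a2 := abs_sub (1 + tailSeries b y) (1 + tailSeries b x)
      have a3 : 1 / (1 - 0.66847) ^ 3 * (y - x) ^ 2 ≤ 28 * |y - x| ^ 2 := by
        rw [sq_abs]; exact mul_le_mul_of_nonneg_right (by norm_num) (sq_nonneg _)
      linarith [hx.2, hy.2]
    rw [abs_mul] at h4
    have h5 := mul_le_mul_of_nonneg_right h3 (abs_nonneg (y - x))
    -- The mesh `1 / (56 * 10 ^ 9)` makes the quadratic term `28 * |y - x| ^ 2` at most half of the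
    -- linear lower bound `|y - x| / 10 ^ 9`; the other half yields `12 * 10 ^ 9 * δ`.
    have h6 : |y - x| ^ 2 ≤ 1 / (56 * 10 ^ 9) * |y - x| := by
      rw [sq]
      refine mul_le_mul_of_nonneg_right (hxy.trans (le_of_eq ?_)) (abs_nonneg _)
      norm_num
    linarith

/-- `(0, 0.66847)` is an interval of transversality. -/
theorem isTransversalityInterval_066847 : IsTransversalityInterval 0.66847 := by
  -- The final `+ 1` makes the inequality strict.
  refine ⟨2 + 56 * 10 ^ 9 * (12 * 10 ^ 9) + 1, by positivity, fun i j hij δ hδ => ?_⟩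
  have hcases : (i 0 = 1 ∧ j 0 = 0) ∨ (j 0 = 1 ∧ i 0 = 0) := by
    revert hij
    generalize i 0 = a
    generalize j 0 = c
    revert a c
    decide
  have hbound : volume {l : ℝ | l ∈ Ioo 0 0.66847 ∧ |natProj l i - natProj l j| < δ} ≤
      ENNReal.ofReal (2 * δ) +
        (56 * 10 ^ 9 : ℕ) * ENNReal.ofReal (12 * 10 ^ 9 * δ) := by
    rcases hcases with ⟨hi, hj⟩ | ⟨hj, hi⟩
    · exact volume_natProj_sub_lt hi hj hδ
    · have := volume_natProj_sub_lt hj hi hδ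
      simpa only [abs_sub_comm] using this
  refine hbound.trans_lt ?_
  rw [← ENNReal.ofReal_natCast, ← ENNReal.ofReal_mul (by positivity),
    ← ENNReal.ofReal_add (by positivity) (by positivity),
    ENNReal.ofReal_lt_ofReal_iff (by positivity)]
  push_cast
  linarith

/-! ### Local dimensions from dyadic radii. -/

lemma le_localDimQuotient {ν : Measure ℝ} {x r s : ℝ} (hr0 : 0 < r) (hr1 : r < 1)
    (h : ν (Metric.ball x r) ≤ ENNReal.ofReal (r ^ s)) : (s : EReal) ≤ localDimQuotient ν x r := by
  have hlog : Real.log r < 0 := Real.log_neg hr0 hr1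
  have h1 : ENNReal.log (ν (Metric.ball x r)) ≤ ((s * Real.log r : ℝ) : EReal) := by
    refine (ENNReal.log_monotone h).trans ?_
    rw [ENNReal.log_ofReal_of_pos (Real.rpow_pos_of_pos hr0 s), Real.log_rpow hr0]
  have h2 := EReal.div_le_div_right_of_nonpos (c := ((Real.log r : ℝ) : EReal))
    (by exact_mod_cast hlog.le) h1
  rw [← EReal.coe_div, mul_div_cancel_right₀ _ hlog.ne] at h2
  exact h2

lemma localDimQuotient_le {ν : Measure ℝ} {x r t : ℝ} (hr0 : 0 < r) (hr1 : r < 1)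
    (h : ENNReal.ofReal (r ^ t) ≤ ν (Metric.ball x r)) : localDimQuotient ν x r ≤ (t : EReal) := by
  have hlog : Real.log r < 0 := Real.log_neg hr0 hr1
  have h1 : ((t * Real.log r : ℝ) : EReal) ≤ ENNReal.log (ν (Metric.ball x r)) := by
    refine le_trans ?_ (ENNReal.log_monotone h)
    rw [ENNReal.log_ofReal_of_pos (Real.rpow_pos_of_pos hr0 t), Real.log_rpow hr0]
  have h2 := EReal.div_le_div_right_of_nonpos (c := ((Real.log r : ℝ) : EReal))
    (by exact_mod_cast hlog.le) h1
  rw [← EReal.coe_div, mul_div_cancel_right₀ _ hlog.ne] at h2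
  exact h2

lemma eventually_const_mul_rpow_le {c a : ℝ} (ha : 0 < a) :
    ∀ᶠ r : ℝ in 𝓝[>] 0, c * r ^ a ≤ 1 := by
  have h : Tendsto (fun r : ℝ => c * r ^ a) (𝓝[>] 0) (𝓝 (c * 0 ^ a)) :=
    (((Real.continuous_rpow_const ha.le).tendsto 0).mono_left nhdsWithin_le_nhds).const_mul c
  rw [Real.zero_rpow ha.ne', mul_zero] at h
  exact (h.eventually (gt_mem_nhds zero_lt_one)).mono fun r hr => hr.le

lemma eventually_dyadic {P : ℕ → Prop} (h : ∀ᶠ k in atTop, P k) :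
    ∀ᶠ r : ℝ in 𝓝[>] 0, 0 < r ∧ r < 1 ∧
      ∃ k : ℕ, P k ∧ P (k + 1) ∧ (1 / 2 : ℝ) ^ (k + 1) < r ∧ r ≤ (1 / 2) ^ k := by
  obtain ⟨K, hK⟩ := eventually_atTop.1 h
  have hpos : (0 : ℝ) < (1 / 2) ^ K := by positivity
  filter_upwards [Ioo_mem_nhdsGT hpos, Ioo_mem_nhdsGT zero_lt_one] with r hr hr1
  obtain ⟨k, hk1, hk2⟩ := exists_nat_pow_near_of_lt_one hr.1 hr1.2.le
    (by norm_num : (0 : ℝ) < 1 / 2) (by norm_num)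
  have hKk : K ≤ k := by
    have := (pow_lt_pow_iff_right_of_lt_one₀ (by norm_num : (0 : ℝ) < 1 / 2) (by norm_num)).1
      (hk1.trans hr.2)
    omega
  exact ⟨hr.1, hr1.2, k, hK k hKk, hK _ (hKk.trans k.le_succ), hk1, hk2⟩

/-- Replacing a radius by a dyadic one costs a constant factor `2 ^ s'`, absorbed for small radii by
the gap between `s` and `s'`. -/
lemma eventually_le_localDimQuotient {ν : Measure ℝ} {x s s' : ℝ} (hs : 0 ≤ s') (hss : s < s')
    (h : ∀ᶠ k : ℕ in atTop,
      ν (Metric.ball x ((1 / 2) ^ k)) ≤ ENNReal.ofReal (((1 / 2 : ℝ) ^ k) ^ s')) :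
    ∀ᶠ r : ℝ in 𝓝[>] 0, (s : EReal) ≤ localDimQuotient ν x r := by
  filter_upwards [eventually_dyadic h, eventually_const_mul_rpow_le (c := 2 ^ s') (sub_pos.2 hss)]
    with r hr hc
  obtain ⟨h0, h1, k, hk, -, hk1, hk2⟩ := hr
  refine le_localDimQuotient h0 h1 ((measure_mono (Metric.ball_subset_ball hk2)).trans
    (hk.trans (ENNReal.ofReal_le_ofReal ?_)))
  have h2 : (1 / 2 : ℝ) ^ k ≤ 2 * r := by
    rw [pow_succ] at hk1; linarith
  calc ((1 / 2 : ℝ) ^ k) ^ s' ≤ (2 * r) ^ s' := by gcongr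
    _ = (2 ^ s' * r ^ (s' - s)) * r ^ s := by
      rw [Real.mul_rpow (by norm_num) h0.le, mul_assoc, ← Real.rpow_add h0]; simp
    _ ≤ 1 * r ^ s := by gcongr
    _ = r ^ s := one_mul _

lemma eventually_localDimQuotient_le {ν : Measure ℝ} {x t t' : ℝ} (ht : 0 ≤ t') (htt : t' < t)
    (h : ∀ᶠ k : ℕ in atTop,
      ENNReal.ofReal (((1 / 2 : ℝ) ^ k) ^ t') ≤ ν (Metric.ball x ((1 / 2) ^ k))) :
    ∀ᶠ r : ℝ in 𝓝[>] 0, localDimQuotient ν x r ≤ (t : EReal) := by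
  filter_upwards [eventually_dyadic h, eventually_const_mul_rpow_le (c := 2 ^ t') (sub_pos.2 htt)]
    with r hr hc
  obtain ⟨h0, h1, k, -, hk, hk1, hk2⟩ := hr
  refine localDimQuotient_le h0 h1 (le_trans (ENNReal.ofReal_le_ofReal ?_)
    (hk.trans (measure_mono (Metric.ball_subset_ball hk1.le))))
  have h2 : r / 2 ≤ (1 / 2 : ℝ) ^ (k + 1) := by
    rw [pow_succ]; linarith
  calc r ^ t = (r / 2) ^ t' * (2 ^ t' * r ^ (t - t')) := by
        rw [Real.div_rpow h0.le (by norm_num), ← mul_assoc,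
          div_mul_cancel₀ _ (Real.rpow_pos_of_pos two_pos _).ne', ← Real.rpow_add h0]; simp
    _ ≤ (r / 2) ^ t' * 1 := by gcongr
    _ = (r / 2) ^ t' := mul_one _
    _ ≤ _ := by gcongr

lemma le_lowerLocalDim {ν : Measure ℝ} {x d : ℝ}
    (h : ∀ s < d, ∀ᶠ r : ℝ in 𝓝[>] 0, (s : EReal) ≤ localDimQuotient ν x r) :
    (d : EReal) ≤ lowerLocalDim ν x := by
  refine le_of_forall_lt fun a ha => ?_
  obtain ⟨s, has, hsd⟩ := EReal.lt_iff_exists_real_btwn.1 ha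
  exact has.trans_le (le_liminf_of_le (by isBoundedDefault) (h s (by exact_mod_cast hsd)))

lemma hasLocalDim_of_eventually {ν : Measure ℝ} {x d : ℝ}
    (h : ∀ s < d, ∀ᶠ r : ℝ in 𝓝[>] 0, (s : EReal) ≤ localDimQuotient ν x r)
    (h' : ∀ t > d, ∀ᶠ r : ℝ in 𝓝[>] 0, localDimQuotient ν x r ≤ (t : EReal)) :
    HasLocalDim ν x d := by
  refine tendsto_order.2 ⟨fun a ha => ?_, fun a ha => ?_⟩
  · obtain ⟨s, has, hsd⟩ := EReal.lt_iff_exists_real_btwn.1 ha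
    exact (h s (by exact_mod_cast hsd)).mono fun r hr => has.trans_le hr
  · obtain ⟨s, has, hsd⟩ := EReal.lt_iff_exists_real_btwn.1 ha
    exact (h' s (by exact_mod_cast has)).mono fun r hr => hr.trans_lt hsd

/-! ### Cylinder weights and the strong law of large numbers. -/

/-- The probability of a digit. -/
noncomputable def digitWeight (p : unitInterval) (a : Fin 2) : ℝ := if a = 0 then (p : ℝ) else 1 - p

/-- The logarithm of the `p`-weight of the first `n` digits. -/
noncomputable def logWeight (p : unitInterval) (i : ℕ → Fin 2) (n : ℕ) : ℝ :=
  ∑ k ∈ Finset.range n, Real.log (digitWeight p (i k))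

/-- The sequences which agree with `i` in the first `n` digits. -/
def cylinderSet (i : ℕ → Fin 2) (n : ℕ) : Set (ℕ → Fin 2) := {j | ∀ k < n, j k = i k}

instance (p : unitInterval) : IsProbabilityMeasure (bernoulliSeqMeasure p) := by
  unfold bernoulliSeqMeasure; infer_instance

lemma digitWeight_pos {p : unitInterval} (hp : (p : ℝ) ∈ Ioo (0 : ℝ) 1) (a : Fin 2) :
    0 < digitWeight p a := by
  unfold digitWeight; split_ifs <;> linarith [hp.1, hp.2]

lemma cylinderSet_eq_pi (i : ℕ → Fin 2) (n : ℕ) :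
    cylinderSet i n = Set.pi (Finset.range n) fun k => {i k} := by
  ext j; simp [cylinderSet]

lemma measurableSet_cylinderSet (i : ℕ → Fin 2) (n : ℕ) : MeasurableSet (cylinderSet i n) := by
  rw [cylinderSet_eq_pi]
  exact MeasurableSet.pi (Finset.countable_toSet _) fun k _ => measurableSet_singleton _

lemma bernoulliSeqMeasure_cylinderSet {p : unitInterval} (hp : (p : ℝ) ∈ Ioo (0 : ℝ) 1)
    (i : ℕ → Fin 2) (n : ℕ) :
    bernoulliSeqMeasure p (cylinderSet i n) = ENNReal.ofReal (Real.exp (logWeight p i n)) := by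
  have hdigit : ∀ a : Fin 2, ProbabilityTheory.bernoulliMeasure (0 : Fin 2) 1 p {a} =
      ENNReal.ofReal (digitWeight p a) := by
    intro a
    rw [ENNReal.ofReal, ProbabilityTheory.bernoulliMeasure_apply p (measurableSet_singleton a)]
    have e1 : unitInterval.toNNReal p = Real.toNNReal p := by
      ext; simp [p.2.1]
    have e2 : unitInterval.toNNReal (unitInterval.symm p) = Real.toNNReal (1 - p) := by
      ext; simp [p.2.2]
    fin_cases a <;> simp [digitWeight, e1, e2]
  rw [cylinderSet_eq_pi, bernoulliSeqMeasure, Measure.infinitePi_pi _ (by simp), logWeight,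
    Real.exp_sum, ENNReal.ofReal_prod_of_nonneg (fun _ _ => (Real.exp_pos _).le)]
  refine Finset.prod_congr rfl fun k _ => ?_
  rw [hdigit, Real.exp_log (digitWeight_pos hp _)]

/-- The almost sure exponential rate of the `p`-weights with respect to the `q`-measure. -/
noncomputable def weightRate (p q : unitInterval) : ℝ :=
  (q : ℝ) * Real.log p + (1 - (q : ℝ)) * Real.log (1 - (p : ℝ))

lemma ae_tendsto_logWeight (p q : unitInterval) :
    ∀ᵐ i ∂(bernoulliSeqMeasure q),
      Tendsto (fun n : ℕ => logWeight p i n / n) atTop (𝓝 (weightRate p q)) := by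
  set f : Fin 2 → ℝ := fun a => Real.log (digitWeight p a) with hf
  have hfm : Measurable f := measurable_of_countable f
  have hmap : ∀ k, Measure.map (fun i : ℕ → Fin 2 => i k) (bernoulliSeqMeasure q) =
      ProbabilityTheory.bernoulliMeasure (0 : Fin 2) 1 q := fun k =>
    Measure.infinitePi_map_eval _ k
  have hint : Integrable (fun i : ℕ → Fin 2 => f (i 0)) (bernoulliSeqMeasure q) := by
    refine Integrable.of_bound (C := max ‖f 0‖ ‖f 1‖)
      (hfm.comp (measurable_pi_apply 0)).aestronglyMeasurable (Eventually.of_forall fun i => ?_)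
    generalize i 0 = a
    fin_cases a <;> simp
  have hindep : Pairwise fun k m : ℕ => ProbabilityTheory.IndepFun
      (fun i : ℕ → Fin 2 => f (i k)) (fun i => f (i m)) (bernoulliSeqMeasure q) := by
    intro k m hkm
    exact (ProbabilityTheory.iIndepFun_infinitePi (X := fun _ : ℕ => f) fun _ => hfm).indepFun hkm
  have hident : ∀ k : ℕ, ProbabilityTheory.IdentDistrib (fun i : ℕ → Fin 2 => f (i k))
      (fun i : ℕ → Fin 2 => f (i 0)) (bernoulliSeqMeasure q) (bernoulliSeqMeasure q) := by
    intro k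
    have : ProbabilityTheory.IdentDistrib (fun i : ℕ → Fin 2 => i k)
      (fun i : ℕ → Fin 2 => i 0) (bernoulliSeqMeasure q) (bernoulliSeqMeasure q) :=
      ⟨(measurable_pi_apply k).aemeasurable, (measurable_pi_apply 0).aemeasurable, by
        rw [hmap, hmap]⟩
    exact this.comp hfm
  have h := ProbabilityTheory.strong_law_ae_real (fun (k : ℕ) (i : ℕ → Fin 2) => f (i k)) hint
    hindep hident
  have hmean : ∫ i, f (i 0) ∂(bernoulliSeqMeasure q) = weightRate p q := by
    rw [← integral_map (f := f) (φ := fun i : ℕ → Fin 2 => i 0)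
      (measurable_pi_apply 0).aemeasurable hfm.aestronglyMeasurable, hmap,
      ProbabilityTheory.integral_bernoulliMeasure]
    simp [hf, digitWeight, weightRate]
  rw [hmean] at h
  exact h

/-- Eventually the terms lie below a geometric sequence of ratio exp(d - c) with χ < d < c. With `S`
the log-weight of a typical sequence, this makes the transversality sum converge. -/
lemma summable_exp_sub {S : ℕ → ℝ} {χ c : ℝ} (h : Tendsto (fun n : ℕ => S n / n) atTop (𝓝 χ))
    (hc : χ < c) : Summable fun n : ℕ => Real.exp (S n - n * c) := by
  obtain ⟨d, hd1, hd2⟩ := exists_between hc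
  have hgeo : Summable fun n : ℕ => Real.exp (d - c) ^ n :=
    summable_geometric_of_lt_one (Real.exp_pos _).le (Real.exp_lt_one_iff.2 (by linarith))
  refine hgeo.of_norm_bounded_eventually_nat ?_
  filter_upwards [h.eventually (gt_mem_nhds hd1), eventually_gt_atTop 0] with n hn hn0
  have hn0' : (0 : ℝ) < n := by exact_mod_cast hn0
  rw [div_lt_iff₀ hn0'] at hn
  rw [Real.norm_of_nonneg (Real.exp_pos _).le, ← Real.exp_nat_mul]
  exact Real.exp_le_exp.2 (by linarith)

lemma natProj_eq_sum_add {l : ℝ} (hl : l ∈ Ioo (0 : ℝ) 1) (i : ℕ → Fin 2) (n : ℕ) :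
    natProj l i = ∑ k ∈ Finset.range n, ((i k : ℕ) : ℝ) * l ^ (k + 1) +
      l ^ n * natProj l (fun k => i (k + n)) := by
  have h := (natProj_summable hl i).sum_add_tsum_nat_add n
  rw [natProj, ← h, natProj, ← tsum_mul_left]
  congr 1
  exact tsum_congr fun k => by ring

lemma natProj_sub_of_mem_cylinderSet {l : ℝ} (hl : l ∈ Ioo (0 : ℝ) 1) {i j : ℕ → Fin 2} {n : ℕ}
    (h : j ∈ cylinderSet i n) : natProj l i - natProj l j =
      l ^ n * (natProj l (fun k => i (k + n)) - natProj l (fun k => j (k + n))) := by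
  rw [natProj_eq_sum_add hl i n, natProj_eq_sum_add hl j n]
  have : ∑ k ∈ Finset.range n, ((j k : ℕ) : ℝ) * l ^ (k + 1) =
      ∑ k ∈ Finset.range n, ((i k : ℕ) : ℝ) * l ^ (k + 1) :=
    Finset.sum_congr rfl fun k hk => by rw [h k (Finset.mem_range.1 hk)]
  rw [this]; ring

lemma natProj_mem_Icc {l : ℝ} (hl : l ∈ Ioo (0 : ℝ) 1) (i : ℕ → Fin 2) :
    natProj l i ∈ Icc 0 (l / (1 - l)) := by
  have hg := hasSum_geometric_succ (x := l) ⟨hl.1.le, hl.2⟩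
  have hpow : ∀ k : ℕ, 0 ≤ l ^ (k + 1) := fun k => pow_nonneg hl.1.le _
  refine ⟨tsum_nonneg fun k => mul_nonneg (Nat.cast_nonneg _) (hpow k), ?_⟩
  refine hasSum_le (fun k => ?_) (natProj_summable hl i).hasSum hg
  have h1 : ((i k : ℕ) : ℝ) ≤ 1 := by
    have : (i k : ℕ) ≤ 1 := by omega
    exact_mod_cast this
  exact mul_le_of_le_one_left (hpow k) h1

lemma bernoulliConv_ball {l : ℝ} (hl : l ∈ Ioo (0 : ℝ) 1) (p : unitInterval) (x r : ℝ) :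
    bernoulliConv l p (Metric.ball x r) = bernoulliSeqMeasure p {j | |x - natProj l j| < r} := by
  rw [bernoulliConv, Measure.map_apply (measurable_natProj hl) Metric.isOpen_ball.measurableSet]
  congr 1
  ext j
  simp [Real.dist_eq, abs_sub_comm]

lemma ae_bernoulliConv_iff {l : ℝ} (hl : l ∈ Ioo (0 : ℝ) 1) {q : unitInterval} {P : ℝ → Prop}
    (hP : MeasurableSet {x | P x}) : (∀ᵐ x ∂(bernoulliConv l q), P x) ↔
      ∀ᵐ i ∂(bernoulliSeqMeasure q), P (natProj l i) :=
  ae_map_iff (measurable_natProj hl).aemeasurable hP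

instance (l : ℝ) (p : unitInterval) : SFinite (bernoulliConv l p) := by
  unfold bernoulliConv; infer_instance

lemma measurableSet_setOf_eventually {X : Type*} [MeasurableSpace X] {P : ℕ → X → Prop}
    (h : ∀ k, MeasurableSet {x | P k x}) : MeasurableSet {x | ∀ᶠ k in atTop, P k x} := by
  have : {x | ∀ᶠ k in atTop, P k x} = ⋃ N, ⋂ k ≥ N, {x | P k x} := by
    ext x; simp [eventually_atTop]
  rw [this]
  exact .iUnion fun N => .iInter fun k => .iInter fun _ => h k

lemma weightRate_neg {p q : unitInterval} (hp : (p : ℝ) ∈ Ioo (0 : ℝ) 1)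
    (hq : (q : ℝ) ∈ Ioo (0 : ℝ) 1) : weightRate p q < 0 := by
  have h1 := Real.log_neg hp.1 hp.2
  have h2 : Real.log (1 - p) < 0 := Real.log_neg (by linarith [hp.2]) (by linarith [hp.1])
  exact add_neg (mul_neg_of_pos_of_neg hq.1 h1) (mul_neg_of_pos_of_neg (by linarith [hq.2]) h2)

lemma measurable_measure_ball (ν : Measure ℝ) [SFinite ν] (r : ℝ) :
    Measurable fun x => ν (Metric.ball x r) := by
  have ho : IsOpen {z : ℝ × ℝ | dist z.2 z.1 < r} :=
    isOpen_lt (by fun_prop) continuous_const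
  exact measurable_measure_prodMk_left ho.measurableSet

/-! ### Upper bound: a ball contains a cylinder. -/

/-- The dyadic form of the upper bound for the local dimension. -/
lemma ae_eventually_le_ball {p : unitInterval} (hp : (p : ℝ) ∈ Ioo (0 : ℝ) 1)
    {q : unitInterval} (hq : (q : ℝ) ∈ Ioo (0 : ℝ) 1) {l : ℝ} (hl : l ∈ Ioo (0 : ℝ) 1) {t : ℝ}
    (ht : weightRate p q / Real.log l < t) :
    ∀ᵐ x ∂(bernoulliConv l q), ∀ᶠ k : ℕ in atTop,
      ENNReal.ofReal (((1 / 2 : ℝ) ^ k) ^ t) ≤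
        bernoulliConv l p (Metric.ball x ((1 / 2) ^ k)) := by
  have hlog : Real.log l < 0 := Real.log_neg hl.1 hl.2
  rw [div_lt_iff_of_neg hlog] at ht
  obtain ⟨c, hc1, hc2⟩ := exists_between ht
  refine (ae_bernoulliConv_iff hl (measurableSet_setOf_eventually fun k =>
    measurableSet_le measurable_const (measurable_measure_ball (bernoulliConv l p) _))).2 ?_
  filter_upwards [ae_tendsto_logWeight p q] with i hi
  -- The `m` extra digits absorb the diameter bound `l / (1 - l)` of the projected space; the
  -- remaining `⌈k * L⌉₊` digits contract by a factor at most `(1 / 2) ^ k`.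
  obtain ⟨m, hm⟩ := exists_pow_lt_of_lt_one (sub_pos.2 hl.2) hl.2
  set L : ℝ := Real.log 2 / (-Real.log l) with hL
  have hlog2 : 0 < Real.log 2 := Real.log_pos one_lt_two
  have hL0 : 0 < L := div_pos hlog2 (by linarith)
  set n : ℕ → ℕ := fun k => ⌈k * L⌉₊ + m with hn
  have hn1 : ∀ k : ℕ, (k * L : ℝ) ≤ n k - m := fun k => by
    simp only [hn]; push_cast; linarith [Nat.le_ceil (k * L : ℝ)]
  have hn2 : ∀ k : ℕ, (n k : ℝ) ≤ k * L + (1 + m) := fun k => by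
    simp only [hn]; push_cast
    linarith [(Nat.ceil_lt_add_one (mul_nonneg (Nat.cast_nonneg k) hL0.le)).le]
  have hnt : Tendsto n atTop atTop := by
    refine tendsto_natCast_atTop_iff.1 (tendsto_atTop_mono (fun k => ?_)
      (tendsto_natCast_atTop_atTop.atTop_mul_const hL0))
    linarith [hn1 k, (Nat.cast_nonneg m : (0 : ℝ) ≤ m)]
  have hS := hnt.eventually ((hi.eventually (lt_mem_nhds hc2)).and (eventually_gt_atTop 0))
  have hc0 : c < 0 := hc2.trans (weightRate_neg hp hq)
  have hgap : 0 < L * (c - t * Real.log l) := mul_pos hL0 (by linarith)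
  have hLl : L * Real.log l = -Real.log 2 := by
    rw [hL, div_neg, neg_mul, div_mul_cancel₀ _ hlog.ne]
  -- Beyond this threshold the gap `c - t * Real.log l`, multiplied by `k * L`, outweighs the loss
  -- from the at most `1 + m` surplus digits.
  have hk := (tendsto_natCast_atTop_atTop (R := ℝ)).eventually_ge_atTop
    (-c * (1 + m) / (L * (c - t * Real.log l)))
  filter_upwards [hS, hk] with k hk1 hk2
  have hpos : (0 : ℝ) < n k := by exact_mod_cast hk1.2
  have hlow : c * n k < logWeight p i (n k) := (lt_div_iff₀ hpos).1 hk1.1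
  have hsub : cylinderSet i (n k) ⊆ {j | |natProj l i - natProj l j| < (1 / 2) ^ k} := by
    intro j hj
    have h1 := natProj_mem_Icc hl (fun a => i (a + n k))
    have h2 := natProj_mem_Icc hl (fun a => j (a + n k))
    have h3 : l ^ (n k) ≤ (1 / 2) ^ k * l ^ m := by
      rw [← Real.log_le_log_iff (pow_pos hl.1 _) (by have := hl.1; positivity),
        Real.log_mul (by positivity) (pow_pos hl.1 _).ne', Real.log_pow, Real.log_pow,
        Real.log_pow, one_div, Real.log_inv]
      have := mul_le_mul_of_nonpos_right (hn1 k) hlog.le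
      rw [mul_assoc, hLl] at this
      linarith
    rw [mem_ofPred_eq, natProj_sub_of_mem_cylinderSet hl hj, abs_mul,
      abs_of_pos (pow_pos hl.1 _)]
    have h4 : |natProj l (fun a => i (a + n k)) - natProj l (fun a => j (a + n k))| ≤
        l / (1 - l) := by
      rw [abs_le]; constructor <;> linarith [h1.1, h1.2, h2.1, h2.2]
    have h5 : 0 < 1 - l := sub_pos.2 hl.2
    have h6 : l ^ m * (l / (1 - l)) < 1 := by
      rw [← mul_div_assoc, div_lt_one h5]
      nlinarith [hl.1, hl.2, pow_pos hl.1 m]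
    calc _ ≤ ((1 / 2) ^ k * l ^ m) * (l / (1 - l)) :=
          mul_le_mul h3 h4 (abs_nonneg _) (by have := hl.1; positivity)
      _ = (1 / 2) ^ k * (l ^ m * (l / (1 - l))) := by ring
      _ < (1 / 2) ^ k * 1 := mul_lt_mul_of_pos_left h6 (by positivity)
      _ = (1 / 2) ^ k := mul_one _
  rw [bernoulliConv_ball hl]
  refine le_trans ?_ (measure_mono hsub)
  rw [bernoulliSeqMeasure_cylinderSet hp]
  refine ENNReal.ofReal_le_ofReal ?_
  rw [Real.rpow_def_of_pos (by positivity), Real.log_pow, one_div, Real.log_inv]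
  refine Real.exp_le_exp.2 (le_trans ?_ hlow.le)
  rw [div_le_iff₀ hgap] at hk2
  have h7 := mul_le_mul_of_nonpos_left (hn2 k) hc0.le
  have h8 : (k : ℝ) * (L * (c - t * Real.log l)) = k * L * c + k * t * Real.log 2 := by
    have : L * (c - t * Real.log l) = L * c - t * (L * Real.log l) := by ring
    rw [this, hLl]; ring
  rw [h8] at hk2
  linarith

/-! ### Lower bound: integration over the parameter. -/

/-- A measurable map which is the identity on `(0, 1)` and takes values there. -/
noncomputable def clampUnit (l : ℝ) : ℝ := if l ∈ Ioo (0 : ℝ) 1 then l else 1 / 2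

lemma clampUnit_mem (l : ℝ) : clampUnit l ∈ Ioo (0 : ℝ) 1 := by
  unfold clampUnit
  split_ifs with h
  · exact h
  · constructor <;> norm_num

lemma clampUnit_of_mem {l : ℝ} (hl : l ∈ Ioo (0 : ℝ) 1) : clampUnit l = l := if_pos hl

lemma measurable_clampUnit : Measurable clampUnit :=
  Measurable.ite measurableSet_Ioo measurable_id measurable_const

lemma measurable_natProj_clampUnit :
    Measurable fun z : ℝ × (ℕ → Fin 2) => natProj (clampUnit z.1) z.2 := by
  refine measurable_of_tendsto_metrizable
    (f := fun (N : ℕ) (z : ℝ × (ℕ → Fin 2)) =>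
      ∑ n ∈ Finset.range N, ((z.2 n : ℕ) : ℝ) * clampUnit z.1 ^ (n + 1)) (fun N => ?_) ?_
  · refine Finset.measurable_sum _ (fun n _ => Measurable.mul ?_
      ((measurable_clampUnit.comp measurable_fst).pow_const _))
    exact (measurable_of_countable fun a : Fin 2 => ((a : ℕ) : ℝ)).comp
      ((measurable_pi_apply n).comp measurable_snd)
  · rw [tendsto_pi_nhds]
    exact fun z => (natProj_summable (clampUnit_mem z.1) z.2).hasSum.tendsto_sum_nat

/-- The triples for which the projections of two sequences are `r`-close. -/
def closeTriples (r : ℝ) : Set ((ℝ × (ℕ → Fin 2)) × (ℕ → Fin 2)) :=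
  {z | |natProj (clampUnit z.1.1) z.1.2 - natProj (clampUnit z.1.1) z.2| < r}

lemma measurableSet_closeTriples (r : ℝ) : MeasurableSet (closeTriples r) := by
  refine measurableSet_lt (Measurable.abs (Measurable.sub ?_ ?_)) measurable_const
  · exact measurable_natProj_clampUnit.comp measurable_fst
  · exact measurable_natProj_clampUnit.comp
      ((measurable_fst.comp measurable_fst).prodMk measurable_snd)

/-- The `p`-measure of the sequences whose projection is `r`-close to that of `i`. -/
noncomputable def closeMeasure (p : unitInterval) (r : ℝ) (z : ℝ × (ℕ → Fin 2)) : ENNReal :=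
  bernoulliSeqMeasure p (Prod.mk z ⁻¹' closeTriples r)

lemma measurable_closeMeasure (p : unitInterval) (r : ℝ) : Measurable (closeMeasure p r) :=
  measurable_measure_prodMk_left (measurableSet_closeTriples r)

lemma closeMeasure_eq (p : unitInterval) (r : ℝ) {l : ℝ} (hl : l ∈ Ioo (0 : ℝ) 1)
    (i : ℕ → Fin 2) :
    closeMeasure p r (l, i) = bernoulliConv l p (Metric.ball (natProj l i) r) := by
  rw [bernoulliConv_ball hl, closeMeasure]
  simp only [closeTriples, clampUnit_of_mem hl, preimage_ofPred_eq]

/-- Fubini: after the exchange, the inner integral is the parameter measure that transversality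
controls for each fixed pair of sequences. -/
lemma lintegral_closeMeasure (p : unitInterval) (r : ℝ) (i : ℕ → Fin 2) {a b : ℝ} (ha : 0 < a)
    (hb : b < 1) :
    ∫⁻ l in Ioo a b, closeMeasure p r (l, i) =
      ∫⁻ j, volume {l | l ∈ Ioo a b ∧ |natProj l i - natProj l j| < r}
        ∂(bernoulliSeqMeasure p) := by
  set T : Set (ℝ × (ℕ → Fin 2)) := {z | ((z.1, i), z.2) ∈ closeTriples r} with hT
  have hTm : MeasurableSet T := (measurableSet_closeTriples r).preimage
    ((measurable_fst.prodMk measurable_const).prodMk measurable_snd)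
  have h1 := Measure.prod_apply (μ := volume.restrict (Ioo a b)) (ν := bernoulliSeqMeasure p) hTm
  have h2 := Measure.prod_apply_symm (μ := volume.restrict (Ioo a b))
    (ν := bernoulliSeqMeasure p) hTm
  rw [h1] at h2
  refine Eq.trans ?_ (h2.trans ?_)
  · rfl
  · refine lintegral_congr fun j => ?_
    rw [Measure.restrict_apply (hTm.preimage measurable_prodMk_right)]
    congr 1
    ext l
    simp only [hT, closeTriples, mem_inter_iff, mem_preimage, mem_ofPred_eq]
    constructor
    · rintro ⟨h, hl⟩
      rw [clampUnit_of_mem ⟨ha.trans hl.1, hl.2.trans hb⟩] at h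
      exact ⟨hl, h⟩
    · rintro ⟨hl, h⟩
      rw [clampUnit_of_mem ⟨ha.trans hl.1, hl.2.trans hb⟩]
      exact ⟨h, hl⟩

lemma le_rpow_of_le_min {v : ENNReal} {y s : ℝ} (hy : 0 ≤ y) (hs0 : 0 ≤ s) (hs1 : s ≤ 1)
    (h1 : v ≤ 1) (h : v ≤ ENNReal.ofReal y) : v ≤ ENNReal.ofReal (y ^ s) := by
  rcases le_total y 1 with hy1 | hy1
  · refine h.trans (ENNReal.ofReal_le_ofReal ?_)
    calc y = y ^ (1 : ℝ) := (Real.rpow_one y).symm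
      _ ≤ y ^ s := Real.rpow_le_rpow_of_exponent_ge_of_imp hy hy1 hs1 (fun _ h0 => by linarith)
  · refine h1.trans ?_
    rw [← ENNReal.ofReal_one]
    exact ENNReal.ofReal_le_ofReal (Real.one_le_rpow hy1 hs0)

/-- The common prefix factors out `l ^ n`, which is at least `a ^ n`; the shifted sequences differ
in their first digit, so transversality applies at scale `r / a ^ n`. -/
lemma volume_close_le {C b : ℝ} (hb : b < 1)
    (hC : ∀ i j : ℕ → Fin 2, i 0 ≠ j 0 → ∀ δ : ℝ, 0 < δ →
      volume {l : ℝ | l ∈ Ioo 0 b ∧ |natProj l i - natProj l j| < δ} < ENNReal.ofReal (C * δ))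
    {a : ℝ} (ha : 0 < a) {r : ℝ} (hr : 0 < r) {i j : ℕ → Fin 2} {n : ℕ}
    (hj : j ∈ cylinderSet i n) (hn : i n ≠ j n) :
    volume {l | l ∈ Ioo a b ∧ |natProj l i - natProj l j| < r} ≤
      ENNReal.ofReal (C * (r / a ^ n)) := by
  refine (measure_mono ?_).trans
    (hC (fun k => i (k + n)) (fun k => j (k + n)) (by simpa using hn) (r / a ^ n)
      (by positivity)).le
  rintro l ⟨hl, h⟩
  have hl0 : 0 < l := ha.trans hl.1
  refine ⟨⟨hl0, hl.2⟩, ?_⟩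
  rw [natProj_sub_of_mem_cylinderSet ⟨hl0, hl.2.trans hb⟩ hj, abs_mul,
    abs_of_pos (pow_pos hl0 _)] at h
  rw [lt_div_iff₀ (by positivity), mul_comm]
  refine lt_of_le_of_lt (mul_le_mul_of_nonneg_right ?_ (abs_nonneg _)) h
  exact pow_le_pow_left₀ ha.le hl.1.le n

/-- Split the `j` by the length of the prefix shared with `i`. Interpolating the transversality
bound with the trivial bound 1 replaces `a ^ n` by its power with exponent `s`, so that convergence
can be had for every `s` with χ < s log a. -/
lemma lintegral_closeMeasure_le {p : unitInterval} (hp : (p : ℝ) ∈ Ioo (0 : ℝ) 1) {C b : ℝ}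
    (hC0 : 0 < C) (hb : b < 1)
    (hC : ∀ i j : ℕ → Fin 2, i 0 ≠ j 0 → ∀ δ : ℝ, 0 < δ →
      volume {l : ℝ | l ∈ Ioo 0 b ∧ |natProj l i - natProj l j| < δ} < ENNReal.ofReal (C * δ))
    {a : ℝ} (ha : 0 < a) (ha1 : a < 1) {r : ℝ} (hr : 0 < r) {s : ℝ} (hs0 : 0 ≤ s) (hs1 : s ≤ 1)
    (i : ℕ → Fin 2) :
    ∫⁻ l in Ioo a b, closeMeasure p r (l, i) ≤ ENNReal.ofReal ((C * r) ^ s) *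
      ∑' n : ℕ, ENNReal.ofReal (Real.exp (logWeight p i n - n * (s * Real.log a))) := by
  rw [lintegral_closeMeasure p r i ha hb]
  have hCr : 0 < C * r := mul_pos hC0 hr
  set f : ℕ → ℝ := fun n => (C * r) ^ s * Real.exp (-(n * (s * Real.log a))) with hf
  have hfe : ∀ n, f n = (C * (r / a ^ n)) ^ s := by
    intro n
    rw [← mul_div_assoc, Real.div_rpow hCr.le (pow_nonneg ha.le n),
      Real.rpow_def_of_pos (pow_pos ha n), Real.log_pow, div_eq_mul_inv, ← Real.exp_neg]
    simp only [hf]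
    congr 3
    ring
  have hpt : ∀ j, volume {l | l ∈ Ioo a b ∧ |natProj l i - natProj l j| < r} ≤
      ∑' n : ℕ, (cylinderSet i n).indicator (fun _ => ENNReal.ofReal (f n)) j := by
    intro j
    -- On the diagonal every cylinder contains `j`, and the terms are bounded below by `(C * r) ^
    -- s`, so the right side is infinite.
    by_cases hij : i = j
    · have : ∑' n : ℕ, (cylinderSet i n).indicator (fun _ => ENNReal.ofReal (f n)) j = ⊤ := by
        rw [← top_le_iff, ← ENNReal.tsum_const_eq_top_of_ne_zero (α := ℕ)
          (c := ENNReal.ofReal ((C * r) ^ s))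
          (by rw [Ne, ENNReal.ofReal_eq_zero, not_le]; positivity)]
        refine ENNReal.tsum_le_tsum fun n => ?_
        rw [indicator_of_mem (show j ∈ cylinderSet i n from fun k _ => by rw [hij])]
        refine ENNReal.ofReal_le_ofReal (le_mul_of_one_le_right (by positivity) ?_)
        rw [Real.one_le_exp_iff, neg_nonneg]
        exact mul_nonpos_of_nonneg_of_nonpos (Nat.cast_nonneg n)
          (mul_nonpos_of_nonneg_of_nonpos hs0 (Real.log_neg ha ha1).le)
      rw [this]; exact le_top
    · have hex : ∃ n, i n ≠ j n := Function.ne_iff.1 hij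
      classical
      set n := Nat.find hex with hn
      have hmem : j ∈ cylinderSet i n := fun k hk => by
        have := Nat.find_min hex hk
        exact (not_not.1 this).symm
      refine le_trans ?_ (ENNReal.le_tsum n)
      rw [indicator_of_mem hmem, hfe]
      refine le_rpow_of_le_min (by positivity) hs0 hs1 ?_
        (volume_close_le hb hC ha hr hmem (Nat.find_spec hex))
      refine (measure_mono (fun l hl => hl.1)).trans ?_
      rw [Real.volume_Ioo, ← ENNReal.ofReal_one]
      exact ENNReal.ofReal_le_ofReal (by linarith)
  refine (lintegral_mono hpt).trans (le_of_eq ?_)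
  rw [lintegral_tsum fun n =>
    (measurable_const.indicator (measurableSet_cylinderSet i n)).aemeasurable,
    ← ENNReal.tsum_mul_left]
  refine tsum_congr fun n => ?_
  rw [lintegral_indicator_const (measurableSet_cylinderSet i n),
    bernoulliSeqMeasure_cylinderSet hp, hf, ENNReal.ofReal_mul (by positivity), mul_assoc,
    ← ENNReal.ofReal_mul (Real.exp_pos _).le, ← Real.exp_add, neg_add_eq_sub]

/-- The dyadic form of the lower bound for the local dimension, for almost every parameter in an
interval of transversality. -/
lemma ae_ae_eventually_ball_le {p : unitInterval} (hp : (p : ℝ) ∈ Ioo (0 : ℝ) 1) (q : unitInterval)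
    {b : ℝ} (hb1 : b < 1) (hb : IsTransversalityInterval b) {a : ℝ} (ha : 0 < a) (ha1 : a < 1)
    {s s' : ℝ} (hs' : 0 ≤ s') (hss : s' < s) (hs1 : s ≤ 1)
    (has : weightRate p q < s * Real.log a) :
    ∀ᵐ l ∂(volume : Measure ℝ), l ∈ Ioo a b → ∀ᵐ x ∂(bernoulliConv l q), ∀ᶠ k : ℕ in atTop,
      bernoulliConv l p (Metric.ball x ((1 / 2) ^ k)) ≤
        ENNReal.ofReal (((1 / 2 : ℝ) ^ k) ^ s') := by
  obtain ⟨C, hC0, hC⟩ := hb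
  have hs0 : 0 ≤ s := hs'.trans hss.le
  set c : ℕ → ENNReal := fun k => ENNReal.ofReal (((1 / 2 : ℝ) ^ k) ^ (-s')) with hc
  -- Finiteness of this weighted sum forces its terms to 0, which bounds the ball of radius `(1 / 2)
  -- ^ k` by its power with exponent `s'` for all large `k`.
  set Φ : ℝ × (ℕ → Fin 2) → ENNReal := fun z => ∑' k, c k * closeMeasure p ((1 / 2) ^ k) z with hΦ
  have hΦm : Measurable Φ :=
    Measurable.tsum fun k => (measurable_closeMeasure p _).const_mul _
  have hfin : ∀ᵐ i ∂(bernoulliSeqMeasure q), ∀ᵐ l ∂(volume.restrict (Ioo a b)), Φ (l, i) < ⊤ := by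
    filter_upwards [ae_tendsto_logWeight p q] with i hi
    refine ae_lt_top (hΦm.comp measurable_prodMk_right) ?_
    set Z : ENNReal := ∑' n : ℕ,
      ENNReal.ofReal (Real.exp (logWeight p i n - n * (s * Real.log a))) with hZ
    have hZt : Z ≠ ⊤ := (summable_exp_sub hi has).tsum_ofReal_ne_top
    have hint : ∫⁻ l in Ioo a b, Φ (l, i) =
        ∑' k, c k * ∫⁻ l in Ioo a b, closeMeasure p ((1 / 2) ^ k) (l, i) := by
      rw [hΦ, lintegral_tsum (f := fun k l => c k * closeMeasure p ((1 / 2) ^ k) (l, i))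
        fun k => (((measurable_closeMeasure p _).comp
          measurable_prodMk_right).const_mul _).aemeasurable]
      exact tsum_congr fun k => lintegral_const_mul _
        ((measurable_closeMeasure p _).comp measurable_prodMk_right)
    have hgeo : Summable fun k : ℕ => C ^ s * ((1 / 2 : ℝ) ^ (s - s')) ^ k :=
      (summable_geometric_of_lt_one (by positivity)
        (Real.rpow_lt_one (by norm_num) (by norm_num) (sub_pos.2 hss))).mul_left _
    have hterm : ∀ k, c k * ∫⁻ l in Ioo a b, closeMeasure p ((1 / 2) ^ k) (l, i) ≤
        ENNReal.ofReal (C ^ s * ((1 / 2 : ℝ) ^ (s - s')) ^ k) * Z := by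
      intro k
      have hk : (0 : ℝ) < (1 / 2) ^ k := by positivity
      have h := lintegral_closeMeasure_le hp hC0 hb1 hC ha ha1 hk hs0 hs1 i
      refine (mul_le_mul_right h (c k)).trans (le_of_eq ?_)
      rw [← mul_assoc, hc, ← ENNReal.ofReal_mul (by positivity)]
      congr 2
      rw [Real.mul_rpow hC0.le hk.le, ← Real.rpow_natCast ((1 / 2 : ℝ) ^ (s - s')),
        ← Real.rpow_mul (by norm_num), mul_comm (s - s'), Real.rpow_mul (by norm_num),
        Real.rpow_natCast, sub_eq_add_neg, Real.rpow_add hk]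
      ring
    show ∫⁻ l in Ioo a b, Φ (l, i) ≠ ⊤
    rw [hint]
    refine ne_top_of_le_ne_top ?_ (ENNReal.tsum_le_tsum hterm)
    rw [ENNReal.tsum_mul_right]
    exact ENNReal.mul_ne_top hgeo.tsum_ofReal_ne_top hZt
  -- Finiteness was obtained for typical `i` and then almost every `l`; the statement needs the
  -- opposite order.
  have hswap := (Measure.ae_ae_comm (p := fun (i : ℕ → Fin 2) (l : ℝ) => Φ (l, i) < ⊤)
    (measurableSet_lt (hΦm.comp measurable_swap) measurable_const)).1 hfin
  rw [ae_restrict_iff' measurableSet_Ioo] at hswap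
  filter_upwards [hswap] with l hl hlab
  have hl01 : l ∈ Ioo (0 : ℝ) 1 := ⟨ha.trans hlab.1, hlab.2.trans hb1⟩
  refine (ae_bernoulliConv_iff hl01 (measurableSet_setOf_eventually fun k =>
    measurableSet_le (measurable_measure_ball (bernoulliConv l p) _) measurable_const)).2 ?_
  filter_upwards [hl hlab] with i hi
  have hlim := ENNReal.tendsto_atTop_zero_of_tsum_ne_top hi.ne
  filter_upwards [hlim.eventually (gt_mem_nhds zero_lt_one)] with k hk
  rw [← closeMeasure_eq p _ hl01]
  have hk0 : (0 : ℝ) < (1 / 2) ^ k := by positivity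
  have hone : ENNReal.ofReal (((1 / 2 : ℝ) ^ k) ^ s') * c k = 1 := by
    rw [hc, ← ENNReal.ofReal_mul (by positivity), ← Real.rpow_add hk0]; simp
  calc closeMeasure p ((1 / 2) ^ k) (l, i) =
      ENNReal.ofReal (((1 / 2 : ℝ) ^ k) ^ s') * (c k * closeMeasure p ((1 / 2) ^ k) (l, i)) := by
        rw [← mul_assoc, hone, one_mul]
    _ ≤ ENNReal.ofReal (((1 / 2 : ℝ) ^ k) ^ s') * 1 := by gcongr
    _ = _ := mul_one _

/-! ### Assembling the bounds. -/

lemma ae_le_localDimQuotient {p : unitInterval} (hp : (p : ℝ) ∈ Ioo (0 : ℝ) 1)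
    {q : unitInterval} (hq : (q : ℝ) ∈ Ioo (0 : ℝ) 1) {b : ℝ} (hb1 : b < 1)
    (hb : IsTransversalityInterval b) :
    ∀ᵐ l ∂(volume : Measure ℝ), l ∈ Ioo 0 b → ∀ᵐ x ∂(bernoulliConv l q),
      ∀ u < min 1 (weightRate p q / Real.log l),
        ∀ᶠ r : ℝ in 𝓝[>] 0, (u : EReal) ≤ localDimQuotient (bernoulliConv l p) x r := by
  -- Rational parameters keep the exceptional sets countable in number, so a single null set of `l`
  -- serves all exponents.
  have hall : ∀ᵐ l ∂(volume : Measure ℝ), ∀ a s s' : ℚ, (0 : ℝ) < a → (a : ℝ) < 1 →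
      (0 : ℝ) ≤ s' → (s' : ℝ) < s → (s : ℝ) ≤ 1 → weightRate p q < s * Real.log a →
      l ∈ Ioo (a : ℝ) b → ∀ᵐ x ∂(bernoulliConv l q), ∀ᶠ k : ℕ in atTop,
        bernoulliConv l p (Metric.ball x ((1 / 2) ^ k)) ≤
          ENNReal.ofReal (((1 / 2 : ℝ) ^ k) ^ (s' : ℝ)) := by
    simp only [ae_all_iff]
    intro a s s' ha ha1 hs' hss hs1 has
    exact ae_ae_eventually_ball_le hp q hb1 hb ha ha1 hs' hss hs1 has
  filter_upwards [hall] with l hl hlb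
  have hlog : Real.log l < 0 := Real.log_neg hlb.1 (hlb.2.trans hb1)
  have hχ := weightRate_neg hp hq
  have hd : 0 < min 1 (weightRate p q / Real.log l) :=
    lt_min one_pos (div_pos_of_neg_of_neg hχ hlog)
  have hrat : ∀ᵐ x ∂(bernoulliConv l q), ∀ s' : ℚ, (0 : ℝ) ≤ s' →
      (s' : ℝ) < min 1 (weightRate p q / Real.log l) → ∀ᶠ k : ℕ in atTop,
        bernoulliConv l p (Metric.ball x ((1 / 2) ^ k)) ≤
          ENNReal.ofReal (((1 / 2 : ℝ) ^ k) ^ (s' : ℝ)) := by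
    simp only [ae_all_iff]
    intro s' hs' hsd
    obtain ⟨s, hs1, hs2⟩ := exists_rat_btwn hsd
    rw [lt_min_iff] at hs2
    have hs0 : (0 : ℝ) < s := hs'.trans_lt hs1
    have h1 : weightRate p q / s < Real.log l := by
      rw [div_lt_iff₀ hs0, mul_comm]
      exact (lt_div_iff_of_neg hlog).1 hs2.2
    rw [Real.lt_log_iff_exp_lt hlb.1] at h1
    -- Since s < χ / log l, that is χ < s log l, the same inequality holds for some rational `a`
    -- slightly below `l`.
    obtain ⟨a, ha1, ha2⟩ := exists_rat_btwn h1
    have ha0 : (0 : ℝ) < a := (Real.exp_pos _).trans ha1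
    rw [← Real.lt_log_iff_exp_lt ha0, div_lt_iff₀ hs0, mul_comm] at ha1
    exact hl a s s' ha0 (ha2.trans (hlb.2.trans hb1)) hs' hs1 hs2.1.le ha1 ⟨ha2, hlb.2⟩
  filter_upwards [hrat] with x hx u hu
  obtain ⟨s', h1, h2⟩ := exists_rat_btwn (max_lt hu hd)
  rw [max_lt_iff] at h1
  exact eventually_le_localDimQuotient h1.2.le h1.1 (hx s' h1.2.le h2)

lemma ae_localDimQuotient_le {p : unitInterval} (hp : (p : ℝ) ∈ Ioo (0 : ℝ) 1)
    {q : unitInterval} (hq : (q : ℝ) ∈ Ioo (0 : ℝ) 1) {l : ℝ} (hl : l ∈ Ioo (0 : ℝ) 1) :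
    ∀ᵐ x ∂(bernoulliConv l q), ∀ t > weightRate p q / Real.log l,
      ∀ᶠ r : ℝ in 𝓝[>] 0, localDimQuotient (bernoulliConv l p) x r ≤ (t : EReal) := by
  have hd : 0 < weightRate p q / Real.log l :=
    div_pos_of_neg_of_neg (weightRate_neg hp hq) (Real.log_neg hl.1 hl.2)
  have hrat : ∀ᵐ x ∂(bernoulliConv l q), ∀ t : ℚ, weightRate p q / Real.log l < t →
      ∀ᶠ k : ℕ in atTop, ENNReal.ofReal (((1 / 2 : ℝ) ^ k) ^ (t : ℝ)) ≤
        bernoulliConv l p (Metric.ball x ((1 / 2) ^ k)) := by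
    simp only [ae_all_iff]
    exact fun t ht => ae_eventually_le_ball hp hq hl ht
  filter_upwards [hrat] with x hx t ht
  obtain ⟨t', h1, h2⟩ := exists_rat_btwn ht
  exact eventually_localDimQuotient_le (hd.trans h1).le h2 (hx t' h1)

lemma exp_weightRate {p : unitInterval} (hp : (p : ℝ) ∈ Ioo (0 : ℝ) 1) (q : unitInterval) :
    (p : ℝ) ^ (q : ℝ) * (1 - (p : ℝ)) ^ (1 - (q : ℝ)) = Real.exp (weightRate p q) := by
  rw [Real.rpow_def_of_pos hp.1, Real.rpow_def_of_pos (sub_pos.2 hp.2), ← Real.exp_add, weightRate]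
  congr 1
  ring

theorem mainTheorem4 (p q : unitInterval)
    (hp : (p : ℝ) ∈ Ioo (0 : ℝ) 1) (hq : (q : ℝ) ∈ Ioo (0 : ℝ) 1)
    (lstar : ℝ)
    (hlstar : lstar = 0.66847 ∨ (lstar ∈ Ioo (0 : ℝ) 1 ∧ IsTransversalityInterval lstar)) :
    (∀ᵐ l ∂(volume : Measure ℝ),
      l ∈ Ioo (0 : ℝ) (min lstar ((p : ℝ) ^ (q : ℝ) * (1 - (p : ℝ)) ^ (1 - (q : ℝ)))) →
        ∀ᵐ x ∂(bernoulliConv l q),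
          HasLocalDim (bernoulliConv l p) x
            ((((q : ℝ) * Real.log p + (1 - (q : ℝ)) * Real.log (1 - (p : ℝ))) / Real.log l : ℝ) :
              EReal)) ∧
    (∀ᵐ l ∂(volume : Measure ℝ),
      l ∈ Ioo ((p : ℝ) ^ (q : ℝ) * (1 - (p : ℝ)) ^ (1 - (q : ℝ))) lstar →
        ∀ᵐ x ∂(bernoulliConv l q), 1 ≤ lowerLocalDim (bernoulliConv l p) x) := by
  have h1 : lstar < 1 := by
    rcases hlstar with h | h
    · rw [h]; norm_num
    · exact h.1.2
  have hT : IsTransversalityInterval lstar := by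
    rcases hlstar with h | h
    · rw [h]; exact isTransversalityInterval_066847
    · exact h.2
  have hlow := ae_le_localDimQuotient hp hq h1 hT
  rw [exp_weightRate hp q]
  constructor
  · filter_upwards [hlow] with l hl hlI
    have hl1 : l < lstar := hlI.2.trans_le (min_le_left _ _)
    have hl01 : l ∈ Ioo (0 : ℝ) 1 := ⟨hlI.1, hl1.trans h1⟩
    have hlog : Real.log l < 0 := Real.log_neg hl01.1 hl01.2
    -- Dividing by the negative `Real.log l` reverses the inequality: `l` below exp χ means the
    -- quotient is at most 1, so the minimum is the quotient itself.
    have hd : weightRate p q / Real.log l ≤ 1 := by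
      rw [div_le_one_of_neg hlog, Real.log_le_iff_le_exp hl01.1]
      exact (hlI.2.trans_le (min_le_right _ _)).le
    have hl' := hl ⟨hlI.1, hl1⟩
    rw [min_eq_right hd] at hl'
    filter_upwards [hl', ae_localDimQuotient_le hp hq hl01] with x hx hx'
    exact hasLocalDim_of_eventually hx hx'
  · filter_upwards [hlow] with l hl hlI
    have hl0 : 0 < l := (Real.exp_pos _).trans hlI.1
    have hlog : Real.log l < 0 := Real.log_neg hl0 (hlI.2.trans h1)
    have hd : 1 ≤ weightRate p q / Real.log l := by
      rw [one_le_div_of_neg hlog, Real.le_log_iff_exp_le hl0]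
      exact hlI.1.le
    have hl' := hl ⟨hl0, hlI.2⟩
    rw [min_eq_left hd] at hl'
    filter_upwards [hl'] with x hx
    exact le_lowerLocalDim hx
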